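/- Theorem 1.1. Let $Q(z)=\frac{\sqrt z/2}{\sinh(\sqrt z/2)}$ (with $Q(0)=1$), a meromorphic function on $\mathbb C$ with poles exactly at $-(2\pi k)^2$, $k\ge 1$. For $\tau\in\mathbb C$ with $\operatorname{Im}\tau>0$ and real $s>0$ let $$X_\tau(s)=\left\{\frac{1}{(m\tau+n)^2|m\tau+n|^s} : m,n\in\mathbb Z,\ \gcd(m,n)=1\right\}$$ (a set without multiplicities, so that $(m,n)$ and $(-m,-n)$ give one element), and let $$\widehat A(X_\tau(s);t)=\prod_{x\in X_\tau(s)}Q(xt).$$ With $u=e^{2\pi i z}$, $q=e^{2\pi i\tau}$, $u^{1/2}=e^{\pi i z}$, $q^{1/8}=e^{\pi i\tau/4}$, $q^{1/24}=e^{\pi i\tau/12}$, $\theta(z;\tau)=\sum_{n\in\mathbb Z}u^nq^{n^2/2}$ and $\eta(\tau)=q^{1/24}\prod_{n\ge1}(1-q^n)$, let $$\widetilde\Theta(z;\tau)=\exp\left(\frac{\pi}{2}\cdot\frac{z^2}{\operatorname{Im}\tau}\right)u^{1/2}q^{1/8}\,\frac{\theta(z+\frac{\tau}{2}+\frac12;\tau)}{\eta(\tau)^3}.$$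 Then, for every $\tau$ with $\operatorname{Im}\tau>0$, the following hold. 1. For every $z\in\mathbb C$ and every $s>0$ such that no factor $Q(x(2\pi i z)^2)$, $x\in X_\tau(s)$, is at a pole of $Q$, the product $\widehat A(X_\tau(s);(2\pi i z)^2)$ converges unconditionally. 2. For every $z\in\mathbb C\setminus(\mathbb Z\tau+\mathbb Z)$, no factor is at a pole for all sufficiently small $s>0$, $\widetilde\Theta(z;\tau)\ne0$, and $$\lim_{s\to0^+}\widehat A(X_\tau(s);(2\pi i z)^2)=2\pi i z\cdot\widetilde\Theta(z;\tau)^{-1}.$$ 3. At $z=0$ the right-hand side has a removable singularity with value $1$, that is, $2\pi i z\,\widetilde\Theta(z;\tau)^{-1}\to1$ as $z\to0$, $z\ne 0$, and the identity holds with this value: $\widehat A(X_\tau(s);0)\to1$ as $s\to0^+$. -/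

import Mathlib

/-- The characteristic series of the Â-genus, `Q(z) = (√z / 2) / sinh (√z / 2)`, with the
value `1` at `z = 0`. The quotient is an even function of `√z`, so the choice of the square root
is immaterial (see `ahatQ_sq`). Its poles are the points excluded by `AhatRegular`. -/
noncomputable def ahatQ (z : ℂ) : ℂ :=
  if z = 0 then 1
  else (z ^ (1 / 2 : ℂ) / 2) / Complex.sinh (z ^ (1 / 2 : ℂ) / 2)

/-- Independence of the choice of the square root. -/
theorem ahatQ_sq {w : ℂ} (hw : w ≠ 0) :
    ahatQ (w ^ 2) = (w / 2) / Complex.sinh (w / 2) := by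
  have h : ((w ^ 2) ^ (1 / 2 : ℂ)) ^ 2 = w ^ 2 := by
    simp
  rw [ahatQ, if_neg (pow_ne_zero 2 hw)]
  rcases sq_eq_sq_iff_eq_or_eq_neg.mp h with h | h
  · rw [h]
  · rw [h, neg_div, Complex.sinh_neg, neg_div_neg_eq]

/-- `z` is not one of the poles `-(2πk)²`, `k ≥ 1`, of the characteristic series `ahatQ`. -/
def AhatRegular (z : ℂ) : Prop :=
  ∀ k : ℕ, 1 ≤ k → z ≠ -(2 * (Real.pi : ℂ) * (k : ℂ)) ^ 2

/-- The set `X_τ(s)` of the numbers `1 / ((mτ + n)² |mτ + n|^s)` with `gcd(m, n) = 1`. It is a set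
without multiplicities, so the pairs `(m, n)` and `(-m, -n)` contribute one element. -/
def ahatX (τ : UpperHalfPlane) (s : ℝ) : Set ℂ :=
  {x : ℂ | ∃ m n : ℤ, Int.gcd m n = 1 ∧
    x = 1 / (((m : ℂ) * (τ : ℂ) + (n : ℂ)) ^ 2 *
      ((‖(m : ℂ) * (τ : ℂ) + (n : ℂ)‖ ^ s : ℝ) : ℂ))}

/-- The product of the `Q(x t)` over the elements `x` of the set `X`. -/
noncomputable def ahatProd (X : Set ℂ) (t : ℂ) : ℂ :=
  ∏' x : X, ahatQ ((x : ℂ) * t)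

/-- The modified Jacobi theta function
`exp (π z² / (2 Im τ)) u^(1/2) q^(1/8) θ(z + τ/2 + 1/2; τ) / η(τ)³`, where `u = exp (2πiz)`,
`q = exp (2πiτ)`, the powers are `u^(1/2) = exp (πiz)` and `q^(1/8) = exp (πiτ/4)`, and
`θ(z; τ) = ∑ u^n q^(n²/2)` is Mathlib's `jacobiTheta₂`. -/
noncomputable def modTheta (z : ℂ) (τ : UpperHalfPlane) : ℂ :=
  Complex.exp ((Real.pi : ℂ) / 2 * (z ^ 2 / (τ.im : ℂ))) *
    (Complex.exp ((Real.pi : ℂ) * Complex.I * z) *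
      Complex.exp ((Real.pi : ℂ) * Complex.I * (τ : ℂ) / 4)) *
    (jacobiTheta₂ (z + (τ : ℂ) / 2 + 1 / 2) (τ : ℂ) / ModularForm.eta (τ : ℂ) ^ 3)

/-! ### Jacobi's triple product and the product formula for the theta function. -/

section

open Complex Filter Topology Finset

/-! Euler's sine product shows that `1 / Q(x (2πiz)²)` is the product over `k ≥ 1` of `1 - z² x /
k²` (`ahatQ_mul_sq`). A coprime pair up to sign together with `k` is a nonzero lattice point `λ` up
to sign, so at `s = 0` the reciprocal of the genus would formally be the product of `1 - z² / λ²`.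
This product is not absolutely convergent, because the sum of `λ⁻²` is not, and the limit `s → 0`
must account for that.

Inserting the factors `exp (z² x / k²)` gives a product `regProd` that converges absolutely,
uniformly for bounded `s ≥ 0`, so it is continuous as `s → 0` (`tendsto_regProd`). For `s > 0` the
price is the exponential of `-ζ(2) z²` times the sum of `x` over the coprime pairs
(`hasProd_sineProd_primHalf`). That sum is Hecke's regularized Eisenstein series of weight two.
Comparing each term with its integral over a unit interval shows that its limit is the row-by-row
sum minus `π / (2 Im τ)` (`tendsto_tsum_heckeTerm`): the integrals contribute a factor `s`, which
cancels the pole of `ζ(1 + s)`.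

At `s = 0` the regularized product is evaluated by rows (`regProd_zero`). Row `0` gives `sin (πz) /
(πz)`, and row `m ≥ 1` gives `(1 - u qᵐ)(1 - u⁻¹ qᵐ) / (1 - qᵐ)²`, each with an exponential of
Eisenstein type. These exponentials cancel against the limit above, except for `exp (π z² / (2 Im
τ))`. What remains is the triple product expansion of the theta function (`modTheta_eq`). -/

/-- The finite `q`-Pochhammer symbol `(q; q)_k`. -/
noncomputable def qPoch (q : ℂ) (k : ℕ) : ℂ := ∏ i ∈ range k, (1 - q ^ (i + 1))

/-- The Gaussian binomial coefficient. -/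
noncomputable def qChoose (q : ℂ) (n k : ℕ) : ℂ := qPoch q n / (qPoch q k * qPoch q (n - k))

theorem qPoch_succ (q : ℂ) (k : ℕ) : qPoch q (k + 1) = qPoch q k * (1 - q ^ (k + 1)) :=
  prod_range_succ _ _

theorem one_sub_pow_succ_ne_zero {q : ℂ} (hq : ‖q‖ < 1) (k : ℕ) : 1 - q ^ (k + 1) ≠ 0 := by
  intro h
  have h1 : ‖q ^ (k + 1)‖ < 1 := by
    rw [norm_pow]; exact pow_lt_one₀ (norm_nonneg _) hq (Nat.succ_ne_zero k)
  rw [← sub_eq_zero.mp h] at h1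
  simp at h1

theorem qPoch_ne_zero {q : ℂ} (hq : ‖q‖ < 1) (k : ℕ) : qPoch q k ≠ 0 :=
  prod_ne_zero_iff.mpr fun i _ => one_sub_pow_succ_ne_zero hq i

theorem qChoose_zero_right {q : ℂ} (hq : ‖q‖ < 1) (n : ℕ) : qChoose q n 0 = 1 := by
  have := qPoch_ne_zero hq n
  simpa [qChoose, qPoch] using this

theorem qChoose_self {q : ℂ} (hq : ‖q‖ < 1) (n : ℕ) : qChoose q n n = 1 := by
  have := qPoch_ne_zero hq n
  simpa [qChoose, qPoch] using this

/-- The `q`-Pascal rule. It fails at `k = n`: the truncated subtraction in `qChoose` makes `qChoose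
q n (n + 1)` nonzero. -/
theorem qChoose_succ_succ {q : ℂ} (hq : ‖q‖ < 1) {n k : ℕ} (hk : k < n) :
    qChoose q (n + 1) (k + 1) = qChoose q n (k + 1) + q ^ (n - k) * qChoose q n k := by
  obtain ⟨j, rfl⟩ := Nat.exists_eq_add_of_lt hk
  have e1 : k + j + 1 + 1 - (k + 1) = j + 1 := by omega
  have e2 : k + j + 1 - (k + 1) = j := by omega
  have e3 : k + j + 1 - k = j + 1 := by omega
  simp only [qChoose, e1, e2, e3, qPoch_succ]
  have h1 := qPoch_ne_zero hq k
  have h2 := qPoch_ne_zero hq j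
  have h3 := one_sub_pow_succ_ne_zero hq k
  have h4 := one_sub_pow_succ_ne_zero hq j
  field_simp
  ring

/-- The `q`-binomial theorem. -/
theorem prod_one_add_mul_pow {q : ℂ} (hq : ‖q‖ < 1) (x : ℂ) (n : ℕ) :
    ∏ j ∈ range n, (1 + x * q ^ j) =
      ∑ k ∈ range (n + 1), qChoose q n k * q ^ (k.choose 2) * x ^ k := by
  induction n with
  | zero => simp [qChoose, qPoch]
  | succ n ih =>
    have hch (k : ℕ) : (k + 1).choose 2 = k.choose 2 + k := by
      rw [Nat.choose_succ_succ' k 1, Nat.choose_one_right, add_comm]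
    have hlast : (∑ k ∈ range (n + 1), qChoose q n k * q ^ (k.choose 2) * x ^ k) * (x * q ^ n) =
        ∑ k ∈ range n, qChoose q n k * q ^ (k.choose 2) * x ^ k * (x * q ^ n) +
          qChoose q n n * q ^ (n.choose 2) * x ^ n * (x * q ^ n) := by
      rw [sum_range_succ, add_mul, sum_mul]
    -- The two end terms are split off, since the Pascal rule only covers the interior ones.
    rw [prod_range_succ, ih, mul_add, mul_one, hlast, sum_range_succ' _ (n + 1),
      sum_range_succ (fun k => qChoose q (n + 1) (k + 1) * q ^ ((k + 1).choose 2) * x ^ (k + 1)) n,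
      sum_range_succ' (fun k => qChoose q n k * q ^ (k.choose 2) * x ^ k) n]
    have hmid : ∀ k ∈ range n, qChoose q (n + 1) (k + 1) * q ^ ((k + 1).choose 2) * x ^ (k + 1) =
        qChoose q n (k + 1) * q ^ ((k + 1).choose 2) * x ^ (k + 1) +
        qChoose q n k * q ^ (k.choose 2) * x ^ k * (x * q ^ n) := by
      intro k hk
      have hk := mem_range.mp hk
      have hp : q ^ n = q ^ (n - k) * q ^ k := by rw [← pow_add]; congr 1; omega
      rw [qChoose_succ_succ hq hk, hch, hp]
      ring
    rw [sum_congr rfl hmid, sum_add_distrib]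
    simp only [qChoose_self hq, qChoose_zero_right hq, hch]
    ring

/-- The `q`-binomial theorem with `2N` factors, recentred at index `N`. Working with a square root
`p` of `q` keeps the exponent `n(n+1)/2` of `q` integral. -/
theorem finite_triple_product {p u : ℂ} (hp0 : p ≠ 0) (hp : ‖p‖ < 1) (hu : u ≠ 0) (N : ℕ) :
    (∏ j ∈ range N, (1 - u * (p ^ 2) ^ (j + 1))) * ∏ j ∈ range N, (1 - u⁻¹ * (p ^ 2) ^ j) =
      ∑ k ∈ range (N + N + 1), qChoose (p ^ 2) (N + N) k *
        ((-u) ^ ((k : ℤ) - N) * p ^ (((k : ℤ) - N) * ((k : ℤ) - N + 1))) := by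
  have hq : ‖p ^ 2‖ < 1 := by
    rw [norm_pow]; exact pow_lt_one₀ (norm_nonneg _) hp two_ne_zero
  -- This argument makes factor `N + j` equal to `1 - u q^(j+1)`. The first `N` factors, read
  -- backwards, are monomials times `1 - u⁻¹ q^j`.
  have key := prod_one_add_mul_pow hq (-u * p ^ (2 - 2 * (N : ℤ))) (N + N)
  have hu' : -u ≠ 0 := neg_ne_zero.mpr hu
  have hsecond : ∏ j ∈ range N, (1 + (-u * p ^ (2 - 2 * (N : ℤ))) * (p ^ 2) ^ (N + j)) =
      ∏ j ∈ range N, (1 - u * (p ^ 2) ^ (j + 1)) := by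
    refine prod_congr rfl fun j _ => ?_
    have : p ^ (2 - 2 * (N : ℤ)) * (p ^ 2) ^ (N + j) = (p ^ 2) ^ (j + 1) := by
      rw [← pow_mul, ← pow_mul, ← zpow_natCast, ← zpow_natCast, ← zpow_add₀ hp0]
      congr 1; push_cast; ring
    rw [mul_assoc, this]; ring
  have hfirst : ∏ j ∈ range N, (1 + (-u * p ^ (2 - 2 * (N : ℤ))) * (p ^ 2) ^ j) =
      ((-u) ^ (N : ℤ) * p ^ (-((N : ℤ) * (N - 1)))) * ∏ j ∈ range N, (1 - u⁻¹ * (p ^ 2) ^ j) := by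
    rw [← prod_range_reflect]
    have h1 : ∀ j ∈ range N, (1 + (-u * p ^ (2 - 2 * (N : ℤ))) * (p ^ 2) ^ (N - 1 - j)) =
        (-u * p ^ (-(2 * (j : ℤ)))) * (1 - u⁻¹ * (p ^ 2) ^ j) := by
      intro j hj
      have hj := mem_range.mp hj
      have e1 : p ^ (2 - 2 * (N : ℤ)) * (p ^ 2) ^ (N - 1 - j) = p ^ (-(2 * (j : ℤ))) := by
        rw [← pow_mul, ← zpow_natCast, ← zpow_add₀ hp0]
        congr 1
        have : ((N - 1 - j : ℕ) : ℤ) = N - 1 - j := by omega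
        push_cast [this]; ring
      have e2 : p ^ (-(2 * (j : ℤ))) * (p ^ 2) ^ j = 1 := by
        rw [← pow_mul, ← zpow_natCast, ← zpow_add₀ hp0]
        simp
      rw [mul_assoc, e1]
      linear_combination -(u * u⁻¹) * e2 - mul_inv_cancel₀ hu
    rw [prod_congr rfl h1, prod_mul_distrib, prod_mul_distrib, prod_const, card_range]
    congr 2
    · clear key hsecond h1
      induction N with
      | zero => simp
      | succ n ih =>
        rw [prod_range_succ, ih, ← zpow_add₀ hp0]
        congr 1; push_cast; ring
  rw [prod_range_add, hsecond, hfirst] at key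
  set c : ℂ := (-u) ^ (N : ℤ) * p ^ (-((N : ℤ) * (N - 1))) with hc
  have hc0 : c ≠ 0 := mul_ne_zero (zpow_ne_zero _ hu') (zpow_ne_zero _ hp0)
  have : ∀ k ∈ range (N + N + 1), qChoose (p ^ 2) (N + N) k * (p ^ 2) ^ (k.choose 2) *
      (-u * p ^ (2 - 2 * (N : ℤ))) ^ k = c * (qChoose (p ^ 2) (N + N) k *
        ((-u) ^ ((k : ℤ) - N) * p ^ (((k : ℤ) - N) * ((k : ℤ) - N + 1)))) := by
    intro k _
    have hk : (2 * (k.choose 2 : ℕ) : ℤ) = k * (k - 1) := by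
      rcases k with _ | k
      · simp
      · have h2 : (k + 1).choose 2 * 2 = (k + 1) * k := by
          rw [Nat.choose_two_right, Nat.add_sub_cancel]
          exact Nat.div_mul_cancel (by simpa [mul_comm] using (Nat.even_mul_succ_self k).two_dvd)
        push_cast
        zify at h2
        linarith
    have e1 : (p ^ 2) ^ (k.choose 2) * (p ^ (2 - 2 * (N : ℤ))) ^ k =
        p ^ (-((N : ℤ) * (N - 1))) * p ^ (((k : ℤ) - N) * ((k : ℤ) - N + 1)) := by
      rw [← pow_mul, ← zpow_natCast, ← zpow_natCast, ← zpow_mul, ← zpow_add₀ hp0, ← zpow_add₀ hp0]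
      congr 1
      push_cast
      rw [hk]; ring
    have e2 : (-u) ^ k = (-u) ^ (N : ℤ) * (-u) ^ ((k : ℤ) - N) := by
      rw [← zpow_add₀ hu', ← zpow_natCast]; congr 1; ring
    rw [mul_pow, e2, hc]
    linear_combination (qChoose (p ^ 2) (N + N) k * (-u) ^ (N : ℤ) * (-u) ^ ((k : ℤ) - N)) * e1
  rw [sum_congr rfl this, ← mul_sum] at key
  refine mul_left_cancel₀ hc0 ?_
  rw [← key]; ring

theorem tendsto_qPoch {q : ℂ} (hq : ‖q‖ < 1) :
    Tendsto (qPoch q) atTop (𝓝 (∏' n : ℕ, (1 - q ^ (n + 1)))) :=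
  (ModularForm.multipliable_one_sub_pow hq).hasProd.tendsto_prod_nat

theorem tprod_one_sub_pow_ne_zero {q : ℂ} (hq : ‖q‖ < 1) : ∏' n : ℕ, (1 - q ^ (n + 1)) ≠ 0 := by
  have := tprod_one_add_ne_zero_of_summable (f := fun n : ℕ => -q ^ (n + 1))
    (fun i => by simpa [sub_eq_add_neg] using one_sub_pow_succ_ne_zero hq i)
    (by simpa using (summable_nat_add_iff 1).mpr (summable_geometric_of_lt_one (norm_nonneg _) hq))
  simpa [sub_eq_add_neg] using this

/-- The Pochhammer symbols converge to a nonzero limit, so they and their inverses are bounded. This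
supplies the dominating constant for the limit `N → ∞` of the finite identity. -/
theorem exists_norm_qChoose_le {q : ℂ} (hq : ‖q‖ < 1) : ∃ B, ∀ n k, ‖qChoose q n k‖ ≤ B := by
  have h1 := tendsto_qPoch hq
  have h2 := h1.inv₀ (tprod_one_sub_pow_ne_zero hq)
  obtain ⟨B, hB⟩ := h1.norm.bddAbove_range
  obtain ⟨C, hC⟩ := h2.norm.bddAbove_range
  have hB' (n) : ‖qPoch q n‖ ≤ B := hB ⟨n, rfl⟩
  have hC' (n) : ‖(qPoch q n)⁻¹‖ ≤ C := hC ⟨n, rfl⟩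
  have hC0 : 0 ≤ C := (norm_nonneg _).trans (hC' 0)
  refine ⟨B * (C * C), fun n k => ?_⟩
  rw [qChoose, div_eq_mul_inv, mul_inv, norm_mul, norm_mul]
  have := (norm_nonneg _).trans (hB' 0)
  gcongr <;> simp only [hB', hC']

theorem multipliable_one_sub_mul_pow {q : ℂ} (hq : ‖q‖ < 1) (x : ℂ) :
    Multipliable fun j : ℕ => 1 - x * q ^ j := by
  have := multipliable_one_add_of_summable (f := fun j : ℕ => -(x * q ^ j))
    (by simpa using (summable_geometric_of_lt_one (norm_nonneg _) hq).mul_left ‖x‖)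
  simpa [sub_eq_add_neg] using this

theorem multipliable_one_sub_mul_pow_succ {q : ℂ} (hq : ‖q‖ < 1) (x : ℂ) :
    Multipliable fun j : ℕ => 1 - x * q ^ (j + 1) := by
  simpa [pow_succ, mul_assoc, mul_comm q] using multipliable_one_sub_mul_pow hq (x * q)

/-- The Jacobi triple product. -/
theorem jacobi_triple_product {p u : ℂ} (hp0 : p ≠ 0) (hp : ‖p‖ < 1) (hu : u ≠ 0)
    (hs : Summable fun n : ℤ => ‖(-u) ^ n * p ^ (n * (n + 1))‖) :
    ∑' n : ℤ, (-u) ^ n * p ^ (n * (n + 1)) =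
      (∏' n : ℕ, (1 - (p ^ 2) ^ (n + 1))) * ((∏' n : ℕ, (1 - u * (p ^ 2) ^ (n + 1))) *
        ∏' n : ℕ, (1 - u⁻¹ * (p ^ 2) ^ n)) := by
  have hq : ‖p ^ 2‖ < 1 := by
    rw [norm_pow]; exact pow_lt_one₀ (norm_nonneg _) hp two_ne_zero
  set q := p ^ 2 with hqdef
  set P := ∏' n : ℕ, (1 - q ^ (n + 1)) with hP
  have hP0 : P ≠ 0 := tprod_one_sub_pow_ne_zero hq
  let t : ℤ → ℂ := fun n => (-u) ^ n * p ^ (n * (n + 1))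
  -- The finite identity as a sum over all of `ℤ`. For fixed `n` the central binomial coefficient
  -- tends to `P / (P * P)`.
  let f : ℕ → ℤ → ℂ := fun N n =>
    if n ∈ Finset.Icc (-(N : ℤ)) N then qChoose q (N + N) (n + N).toNat * t n else 0
  have hfsum (N : ℕ) : ∑' n, f N n = (∏ j ∈ range N, (1 - u * q ^ (j + 1))) *
      ∏ j ∈ range N, (1 - u⁻¹ * q ^ j) := by
    rw [finite_triple_product hp0 hp hu, tsum_eq_sum (s := Finset.Icc (-(N : ℤ)) N)
      (fun b hb => if_neg hb)]
    refine Finset.sum_bij' (fun n _ => (n + N).toNat) (fun k _ => (k : ℤ) - N) ?_ ?_ ?_ ?_ ?_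
    · intro n hn; simp only [Finset.mem_Icc] at hn; simp only [mem_range]; omega
    · intro k hk; simp only [mem_range] at hk; simp only [Finset.mem_Icc]; omega
    · intro n hn; simp only [Finset.mem_Icc] at hn; omega
    · intro k hk; simp only [sub_add_cancel, Int.toNat_natCast]
    · intro n hn
      have hn' := Finset.mem_Icc.mp hn
      have : ((n + N).toNat : ℤ) - N = n := by omega
      simp only [if_pos hn, this, t, hqdef]
  obtain ⟨B, hB⟩ := exists_norm_qChoose_le hq
  have hB0 : 0 ≤ B := (norm_nonneg _).trans (hB 0 0)
  have hlim : Tendsto (fun N => ∑' n, f N n) atTop (𝓝 (∑' n, P⁻¹ * t n)) := by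
    refine tendsto_tsum_of_dominated_convergence (hs.mul_left B) (fun n => ?_)
      (Eventually.of_forall fun N n => ?_)
    · have hc : Tendsto (fun N : ℕ => qPoch q (N + N) / (qPoch q (n + N).toNat *
          qPoch q (N + N - (n + N).toNat))) atTop (𝓝 (P / (P * P))) := by
        have h1 := tendsto_qPoch hq
        refine Tendsto.div (h1.comp (tendsto_atTop_mono (fun N => ?_) tendsto_id))
          (Tendsto.mul (h1.comp ?_) (h1.comp ?_)) (mul_ne_zero hP0 hP0)
        · simp
        · exact tendsto_atTop.mpr fun b => by
            filter_upwards [eventually_ge_atTop (b + n.natAbs)] with N hN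
            omega
        · exact tendsto_atTop.mpr fun b => by
            filter_upwards [eventually_ge_atTop (b + n.natAbs)] with N hN
            omega
      have hc' : P / (P * P) = P⁻¹ := by field_simp
      rw [hc'] at hc
      refine (hc.mul_const (t n)).congr' ?_
      filter_upwards [eventually_ge_atTop n.natAbs] with N hN
      have : n ∈ Finset.Icc (-(N : ℤ)) N := by simp only [Finset.mem_Icc]; omega
      simp only [f, if_pos this, qChoose]
    · simp only [f]
      split_ifs
      · rw [norm_mul]; exact mul_le_mul_of_nonneg_right (hB _ _) (norm_nonneg _)
      · rw [norm_zero]; positivity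
  have hlim2 : Tendsto (fun N => ∑' n, f N n) atTop (𝓝 ((∏' n : ℕ, (1 - u * q ^ (n + 1))) *
      ∏' n : ℕ, (1 - u⁻¹ * q ^ n))) := by
    simp only [hfsum]
    exact (multipliable_one_sub_mul_pow_succ hq u).hasProd.tendsto_prod_nat.mul
      (multipliable_one_sub_mul_pow hq u⁻¹).hasProd.tendsto_prod_nat
  rw [← tendsto_nhds_unique hlim hlim2, tsum_mul_left, ← mul_assoc, mul_inv_cancel₀ hP0, one_mul]

/-- The infinite product in the factorization of `modTheta`. -/
noncomputable def thetaProd (q u : ℂ) : ℂ :=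
  ∏' n : ℕ, ((1 - u * q ^ (n + 1)) * (1 - u⁻¹ * q ^ (n + 1)) / (1 - q ^ (n + 1)) ^ 2)

theorem hasProd_thetaProd_aux {q : ℂ} (hq : ‖q‖ < 1) (u : ℂ) :
    HasProd (fun n : ℕ => (1 - u * q ^ (n + 1)) * (1 - u⁻¹ * q ^ (n + 1)) / (1 - q ^ (n + 1)) ^ 2)
      ((∏' n : ℕ, (1 - u * q ^ (n + 1))) * (∏' n : ℕ, (1 - u⁻¹ * q ^ (n + 1))) /
        (∏' n : ℕ, (1 - q ^ (n + 1))) ^ 2) := by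
  have h1 := (multipliable_one_sub_mul_pow_succ hq u).hasProd
  have h2 := (multipliable_one_sub_mul_pow_succ hq u⁻¹).hasProd
  have h3 := (ModularForm.multipliable_one_sub_pow hq).hasProd
  have hne := tprod_one_sub_pow_ne_zero hq
  simpa only [div_eq_mul_inv, sq] using (h1.mul h2).mul ((h3.mul h3).inv₀
    (mul_ne_zero hne hne))

theorem hasProd_thetaProd {q : ℂ} (hq : ‖q‖ < 1) (u : ℂ) :
    HasProd (fun n : ℕ => (1 - u * q ^ (n + 1)) * (1 - u⁻¹ * q ^ (n + 1)) / (1 - q ^ (n + 1)) ^ 2)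
      (thetaProd q u) :=
  (hasProd_thetaProd_aux hq u).multipliable.hasProd

theorem thetaProd_eq {q : ℂ} (hq : ‖q‖ < 1) (u : ℂ) :
    thetaProd q u = (∏' n : ℕ, (1 - u * q ^ (n + 1))) * (∏' n : ℕ, (1 - u⁻¹ * q ^ (n + 1))) /
      (∏' n : ℕ, (1 - q ^ (n + 1))) ^ 2 :=
  (hasProd_thetaProd_aux hq u).tprod_eq

/-- The shift by `τ/2 + 1/2` turns the theta series into the triple product series. Its factor `1 -
u⁻¹` combines with `u^(1/2)` to `2i sin (πz)`, and `η³` removes `q^(1/8)` and supplies the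
denominators. -/
theorem modTheta_eq (z : ℂ) (τ : UpperHalfPlane) :
    modTheta z τ = Complex.exp ((Real.pi : ℂ) / 2 * (z ^ 2 / (τ.im : ℂ))) *
      (2 * I * Complex.sin (Real.pi * z)) *
      thetaProd (cexp (2 * Real.pi * I * τ)) (cexp (2 * Real.pi * I * z)) := by
  set p := cexp (Real.pi * I * τ) with hpdef
  set u := cexp (2 * Real.pi * I * z) with hudef
  have hq2 : cexp (2 * Real.pi * I * τ) = p ^ 2 := by
    rw [hpdef, ← Complex.exp_nat_mul]; congr 1; push_cast; ring
  have hp0 : p ≠ 0 := Complex.exp_ne_zero _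
  have hu : u ≠ 0 := Complex.exp_ne_zero _
  have hq : ‖p ^ 2‖ < 1 := by rw [← hq2]; exact UpperHalfPlane.norm_exp_two_pi_I_lt_one τ
  have hp : ‖p‖ < 1 := by
    rw [norm_pow] at hq
    by_contra h
    exact absurd (one_le_pow₀ (not_lt.mp h) (n := 2)) (not_le.mpr hq)
  have hterm (n : ℤ) : jacobiTheta₂_term n (z + (τ : ℂ) / 2 + 1 / 2) τ =
      (-u) ^ n * p ^ (n * (n + 1)) := by
    have : -u = cexp (Real.pi * I + 2 * Real.pi * I * z) := by
      rw [Complex.exp_add, Complex.exp_pi_mul_I]; simp [hudef]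
    rw [this, hpdef, ← Complex.exp_int_mul, ← Complex.exp_int_mul, ← Complex.exp_add,
      jacobiTheta₂_term]
    congr 1; push_cast; ring
  have hsum : Summable fun n : ℤ => ‖(-u) ^ n * p ^ (n * (n + 1))‖ := by
    have := ((summable_jacobiTheta₂_term_iff (z + (τ : ℂ) / 2 + 1 / 2) τ).mpr τ.im_pos).norm
    simpa only [hterm] using this
  have htheta : jacobiTheta₂ (z + (τ : ℂ) / 2 + 1 / 2) τ =
      (∏' n : ℕ, (1 - (p ^ 2) ^ (n + 1))) * ((∏' n : ℕ, (1 - u * (p ^ 2) ^ (n + 1))) *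
        ∏' n : ℕ, (1 - u⁻¹ * (p ^ 2) ^ n)) := by
    rw [← jacobi_triple_product hp0 hp hu hsum, jacobiTheta₂]
    exact tsum_congr hterm
  have hsplit : ∏' n : ℕ, (1 - u⁻¹ * (p ^ 2) ^ n) =
      (1 - u⁻¹) * ∏' n : ℕ, (1 - u⁻¹ * (p ^ 2) ^ (n + 1)) := by
    have h := (multipliable_one_sub_mul_pow hq u⁻¹).hasProd.tendsto_prod_nat
    have h' := ((multipliable_one_sub_mul_pow_succ hq u⁻¹).hasProd.tendsto_prod_nat).const_mul
      (1 - u⁻¹)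
    refine tendsto_nhds_unique (h.comp (tendsto_add_atTop_nat 1)) (h'.congr fun n => ?_)
    simp [Finset.prod_range_succ', mul_comm]
  have heta : ModularForm.eta (τ : ℂ) ^ 3 = cexp (Real.pi * I * τ / 4) *
      (∏' n : ℕ, (1 - (p ^ 2) ^ (n + 1))) ^ 3 := by
    rw [ModularForm.eta, mul_pow]
    congr 1
    · rw [Function.Periodic.qParam, ← Complex.exp_nat_mul]
      congr 1; push_cast; ring
    · congr 2; ext n
      rw [ModularForm.eta_q_eq_pow, hq2]
  have hsin : cexp (Real.pi * I * z) * (1 - u⁻¹) = 2 * I * Complex.sin (Real.pi * z) := by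
    rw [Complex.sin, hudef, ← Complex.exp_neg, mul_sub, ← Complex.exp_add]
    have e1 : Real.pi * I * z + -(2 * Real.pi * I * z) = -(Real.pi * z) * I := by ring
    have e2 : Real.pi * I * z = Real.pi * z * I := by ring
    rw [e1, e2]
    linear_combination (cexp (Real.pi * z * I) - cexp (-(Real.pi * z) * I)) * I_sq
  have hP0 := tprod_one_sub_pow_ne_zero hq
  rw [modTheta, hq2, thetaProd_eq hq, heta, htheta, hsplit, ← hsin]
  have he := Complex.exp_ne_zero (Real.pi * I * τ / 4)
  field_simp

theorem tendsto_thetaProd_one {q : ℂ} (hq : ‖q‖ < 1) :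
    Tendsto (fun z : ℂ => thetaProd q (cexp (2 * Real.pi * I * z))) (𝓝 0) (𝓝 1) := by
  -- The `n`-th factor of `thetaProd` is `1 - v(z) c(n)`, with `z` and `n` separated; `v` vanishes
  -- at `0` and `c` is summable.
  let v : ℂ → ℂ := fun z => cexp (2 * Real.pi * I * z) + (cexp (2 * Real.pi * I * z))⁻¹ - 2
  let c : ℕ → ℂ := fun n => q ^ (n + 1) / (1 - q ^ (n + 1)) ^ 2
  have hc : Summable fun n => ‖c n‖ := by
    have h1 : Tendsto (fun n : ℕ => 1 / (1 - q ^ (n + 1)) ^ 2) atTop (𝓝 (1 / (1 - 0) ^ 2)) := by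
      refine Tendsto.div tendsto_const_nhds (Tendsto.pow (Tendsto.const_sub _ ?_) 2) (by simp)
      exact (tendsto_pow_atTop_nhds_zero_of_norm_lt_one hq).comp (tendsto_add_atTop_nat 1)
    obtain ⟨B, hB⟩ := h1.norm.bddAbove_range
    refine Summable.of_nonneg_of_le (fun _ => norm_nonneg _) (fun n => ?_)
      (((summable_nat_add_iff 1).mpr (summable_geometric_of_lt_one (norm_nonneg q) hq)).mul_left B)
    have : ‖1 / (1 - q ^ (n + 1)) ^ 2‖ ≤ B := hB ⟨n, rfl⟩
    rw [show c n = 1 / (1 - q ^ (n + 1)) ^ 2 * q ^ (n + 1) by simp only [c]; ring, norm_mul,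
      norm_pow]
    gcongr
  have hv : Tendsto v (𝓝 0) (𝓝 0) := by
    have : ContinuousAt v 0 := by
      have := Complex.exp_ne_zero (2 * Real.pi * I * 0)
      fun_prop (disch := assumption)
    have h0 : v 0 = 0 := by simp [v]; norm_num
    simpa [ContinuousAt, h0] using this
  have heq (z : ℂ) : thetaProd q (cexp (2 * Real.pi * I * z)) = ∏' n, (1 + (-(v z * c n))) := by
    refine tprod_congr fun n => ?_
    have h1 := one_sub_pow_succ_ne_zero hq n
    have h2 := Complex.exp_ne_zero (2 * Real.pi * I * z)
    simp only [v, c]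
    field_simp
    ring
  simp only [heq]
  have := tendsto_tprod_one_add_of_dominated_convergence (𝓕 := 𝓝 (0 : ℂ))
    (f := fun z n => -(v z * c n)) (g := fun _ => 0) hc
    (fun k => by simpa using (hv.mul_const (c k)).neg)
    (by
      have : ∀ᶠ z in 𝓝 (0 : ℂ), ‖v z‖ ≤ 1 := by
        have := hv.norm
        rw [norm_zero] at this
        exact (this.eventually (gt_mem_nhds one_pos)).mono fun _ h => le_of_lt h
      filter_upwards [this] with z hz k
      rw [norm_neg, norm_mul]
      exact mul_le_of_le_one_left (norm_nonneg _) hz)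
  simpa using this

end

/-! ### Hecke's summand and its integral over a unit interval. -/

section

open Complex Filter Topology MeasureTheory

/-- The lattice point `m τ + n`. -/
noncomputable def latticePt (τ : UpperHalfPlane) (p : ℤ × ℤ) : ℂ := p.1 * (τ : ℂ) + p.2

theorem summable_norm_latticePt_rpow (τ : UpperHalfPlane) {r : ℝ} (hr : 2 < r) :
    Summable fun p : ℤ × ℤ => ‖latticePt τ p‖ ^ (-r) := by
  have h1 := (EisensteinSeries.summable_one_div_norm_rpow hr).mul_left
    (EisensteinSeries.r τ ^ (-r))
  have h2 : Summable fun x : Fin 2 → ℤ => ‖(x 0 : ℂ) * (τ : ℂ) + x 1‖ ^ (-r) :=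
    Summable.of_nonneg_of_le (fun _ => by positivity)
      (fun x => EisensteinSeries.summand_bound τ (by linarith) x) h1
  simpa [Function.comp_def, latticePt] using (finTwoArrowEquiv ℤ).symm.summable_iff.mpr h2

/-- The summand `w⁻² |w|⁻ˢ` of Hecke's regularized Eisenstein series of weight two. -/
noncomputable def heckeTerm (s : ℝ) (w : ℂ) : ℂ := (w ^ 2)⁻¹ * ((normSq w ^ (-s / 2) : ℝ) : ℂ)

theorem normSq_rpow (s : ℝ) (w : ℂ) : normSq w ^ (-s / 2) = ‖w‖ ^ (-s) := by
  rw [normSq_eq_norm_sq, ← Real.rpow_natCast, ← Real.rpow_mul (norm_nonneg _)]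
  congr 1; push_cast; ring

theorem heckeTerm_zero (w : ℂ) : heckeTerm 0 w = (w ^ 2)⁻¹ := by simp [heckeTerm]

theorem norm_heckeTerm (s : ℝ) {w : ℂ} (hw : w ≠ 0) : ‖heckeTerm s w‖ = ‖w‖ ^ (-(2 + s)) := by
  have : 0 < ‖w‖ := norm_pos_iff.mpr hw
  rw [heckeTerm, norm_mul, norm_inv, norm_pow, norm_real, normSq_rpow,
    Real.norm_of_nonneg (by positivity), neg_add, Real.rpow_add this, Real.rpow_neg this.le]
  norm_num

/-- Makes the estimates uniform in `s` down to `s = 0`, for points bounded away from the origin. -/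
theorem rpow_neg_le_max {a δ s A : ℝ} (hδ : 0 < δ) (ha : δ ≤ a) (hs0 : 0 ≤ s) (hsA : s ≤ A) :
    a ^ (-s) ≤ max 1 (δ ^ (-A)) := by
  have ha0 : 0 < a := hδ.trans_le ha
  rcases le_total 1 a with h | h
  · exact (Real.rpow_le_one_of_one_le_of_nonpos h (by linarith)).trans (le_max_left _ _)
  · refine le_trans ?_ (le_max_right _ _)
    calc a ^ (-s) ≤ a ^ (-A) := Real.rpow_le_rpow_of_exponent_ge ha0 h (by linarith)
      _ ≤ δ ^ (-A) := Real.rpow_le_rpow_of_nonpos hδ ha (by linarith)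

theorem ne_zero_of_im_pos {w : ℂ} (hw : 0 < w.im) : w ≠ 0 := by
  rintro rfl; simp at hw

theorem normSq_pos_of_im_pos {w : ℂ} (hw : 0 < w.im) : 0 < normSq w :=
  normSq_pos.mpr (ne_zero_of_im_pos hw)

theorem continuous_heckeTerm_add {w : ℂ} (hw : 0 < w.im) :
    Continuous fun p : ℝ × ℝ => heckeTerm p.1 (w + p.2) := by
  have h (p : ℝ × ℝ) : 0 < (w + (p.2 : ℂ)).im := by simpa using hw
  unfold heckeTerm
  refine Continuous.mul (Continuous.inv₀ (by fun_prop) fun p => pow_ne_zero 2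
    (ne_zero_of_im_pos (h p))) (continuous_ofReal.comp (Continuous.rpow ?_ (by fun_prop)
      fun p => Or.inl (normSq_pos_of_im_pos (h p)).ne'))
  exact continuous_normSq.comp (by fun_prop)

theorem continuous_heckeTerm_add_const (s : ℝ) {w : ℂ} (hw : 0 < w.im) :
    Continuous fun x : ℝ => heckeTerm s (w + x) := by
  simpa only [Function.comp_def] using
    (continuous_heckeTerm_add hw).comp (Continuous.prodMk_right (X := ℝ) (Y := ℝ) s)

theorem hasDerivAt_heckeTerm_add (s : ℝ) {w : ℂ} (hw : 0 < w.im) (x : ℝ) :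
    HasDerivAt (fun x : ℝ => heckeTerm s (w + x))
      (-(2 * ((w + x) ^ 3)⁻¹) * ((normSq (w + x) ^ (-s / 2) : ℝ) : ℂ) +
        ((w + x) ^ 2)⁻¹ * ((2 * (w + x).re * (-s / 2) * normSq (w + x) ^ (-s / 2 - 1) : ℝ) : ℂ))
      x := by
  have hx : 0 < (w + (x : ℂ)).im := by simpa using hw
  have hne := ne_zero_of_im_pos hx
  have h1 : HasDerivAt (fun x : ℝ => w + (x : ℂ)) 1 x :=
    (ofRealCLM.hasDerivAt (x := x)).const_add w
  have h2 : HasDerivAt (fun x : ℝ => ((w + (x : ℂ)) ^ 2)⁻¹) (-(2 * ((w + x) ^ 3)⁻¹)) x := by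
    convert! (h1.fun_pow 2).fun_inv (pow_ne_zero 2 hne) using 1
    field_simp
    norm_num
  have h3 : HasDerivAt (fun x : ℝ => normSq (w + (x : ℂ))) (2 * (w + x).re) x := by
    have : (fun x : ℝ => normSq (w + (x : ℂ))) = fun x : ℝ => (w.re + x) ^ 2 + w.im ^ 2 := by
      ext x; simp [normSq_apply]; ring
    rw [this]
    convert! (((hasDerivAt_id x).const_add w.re).pow 2).add_const (w.im ^ 2) using 1
    simp
  have h4 := h3.rpow_const (p := -s / 2) (Or.inl (normSq_pos_of_im_pos hx).ne')
  exact h2.mul h4.ofReal_comp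

/-- Differentiation gains a power of `|w|`; the exponent `3` exceeds `2`, the threshold of absolute
convergence over a lattice. -/
theorem norm_heckeTerm_deriv_le {s : ℝ} (hs : 0 ≤ s) {w : ℂ} (hw : 0 < w.im) :
    ‖-(2 * (w ^ 3)⁻¹) * ((normSq w ^ (-s / 2) : ℝ) : ℂ) +
        (w ^ 2)⁻¹ * ((2 * w.re * (-s / 2) * normSq w ^ (-s / 2 - 1) : ℝ) : ℂ)‖ ≤
      (2 + s) * ‖w‖ ^ (-s) * (‖w‖ ^ 3)⁻¹ := by
  have hpos : 0 < ‖w‖ := norm_pos_iff.mpr (ne_zero_of_im_pos hw)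
  have e : normSq w ^ (-s / 2 - 1) = ‖w‖ ^ (-s) * (‖w‖ ^ 2)⁻¹ := by
    rw [Real.rpow_sub (normSq_pos_of_im_pos hw), normSq_rpow, Real.rpow_one, normSq_eq_norm_sq]
    rfl
  refine (norm_add_le _ _).trans ?_
  rw [norm_mul, norm_mul, norm_real, norm_real, normSq_rpow, e, norm_neg, norm_mul, norm_inv,
    norm_inv, norm_pow, norm_pow, Real.norm_of_nonneg (by positivity : 0 ≤ ‖w‖ ^ (-s)), norm_mul,
    Real.norm_of_nonneg (by positivity : 0 ≤ ‖w‖ ^ (-s) * (‖w‖ ^ 2)⁻¹)]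
  have h2 : ‖2 * w.re * (-s / 2)‖ ≤ s * ‖w‖ := by
    rw [show 2 * w.re * (-s / 2) = -(s * w.re) by ring, norm_neg, norm_mul,
      Real.norm_of_nonneg hs]
    exact mul_le_mul_of_nonneg_left (abs_re_le_norm w) hs
  calc _ ≤ ‖(2 : ℂ)‖ * (‖w‖ ^ 3)⁻¹ * ‖w‖ ^ (-s) +
        (‖w‖ ^ 2)⁻¹ * (s * ‖w‖ * (‖w‖ ^ (-s) * (‖w‖ ^ 2)⁻¹)) := by gcongr
    _ = _ := by
      rw [show ‖(2 : ℂ)‖ = 2 by simp]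
      field_simp

/-- Mean value inequality on the segment from `w` to `w + 1`. The lower bound on `Im w` makes `|w|`
and `|w + x|` comparable there. -/
theorem exists_norm_heckeTerm_sub_integral_le {y : ℝ} (hy : 0 < y) :
    ∃ C : ℝ, ∀ s : ℝ, 0 ≤ s → s ≤ 1 → ∀ w : ℂ, y ≤ w.im →
      ‖heckeTerm s w - ∫ x in (0 : ℝ)..1, heckeTerm s (w + x)‖ ≤ C * ‖w‖ ^ (-3 : ℝ) := by
  -- Here `3` bounds `2 + s`, the maximum bounds `|w + x|^(-s)`, and the cube comes from `|w| ≤ (1 +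
  -- y⁻¹) |w + x|`.
  refine ⟨3 * max 1 (y ^ (-1 : ℝ)) * (1 + y⁻¹) ^ 3, fun s hs0 hs1 w hw => ?_⟩
  have hw0 : 0 < w.im := hy.trans_le hw
  have hwpos : 0 < ‖w‖ := norm_pos_iff.mpr (ne_zero_of_im_pos hw0)
  have e3 : ‖w‖ ^ (-3 : ℝ) = (‖w‖ ^ 3)⁻¹ := by
    rw [Real.rpow_neg hwpos.le]; norm_cast
  rw [e3]
  set K := 3 * max 1 (y ^ (-1 : ℝ)) * (1 + y⁻¹) ^ 3 * (‖w‖ ^ 3)⁻¹ with hK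
  have hderiv (x : ℝ) (hx : x ∈ Set.Icc (0 : ℝ) 1) :
      ‖-(2 * ((w + x) ^ 3)⁻¹) * ((normSq (w + x) ^ (-s / 2) : ℝ) : ℂ) +
        ((w + x) ^ 2)⁻¹ * ((2 * (w + x).re * (-s / 2) * normSq (w + x) ^ (-s / 2 - 1) : ℝ) : ℂ)‖
        ≤ K := by
    have him : y ≤ (w + (x : ℂ)).im := by simpa using hw
    have hnorm : y ≤ ‖w + (x : ℂ)‖ := him.trans ((le_abs_self _).trans (abs_im_le_norm _))
    have hle : ‖w‖ ≤ (1 + y⁻¹) * ‖w + (x : ℂ)‖ := by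
      have h1 : ‖w‖ ≤ ‖w + (x : ℂ)‖ + 1 := by
        have h2 : ‖w‖ = ‖(w + (x : ℂ)) - x‖ := by ring_nf
        rw [h2]
        refine (norm_sub_le _ _).trans (add_le_add_right ?_ _)
        rw [norm_real, Real.norm_of_nonneg hx.1]
        exact hx.2
      have h3 : 1 ≤ y⁻¹ * ‖w + (x : ℂ)‖ := by
        rw [inv_mul_eq_div, one_le_div hy]; exact hnorm
      linarith
    refine (norm_heckeTerm_deriv_le hs0 (hy.trans_le him)).trans ?_
    have hx0 : 0 < ‖w + (x : ℂ)‖ := hy.trans_le hnorm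
    have h4 : (‖w + (x : ℂ)‖ ^ 3)⁻¹ ≤ (1 + y⁻¹) ^ 3 * (‖w‖ ^ 3)⁻¹ := by
      rw [← div_eq_mul_inv, inv_le_comm₀ (by positivity) (by positivity), inv_div,
        div_le_iff₀ (by positivity), mul_comm, ← mul_pow]
      exact pow_le_pow_left₀ hwpos.le hle 3
    have h5 := rpow_neg_le_max hy hnorm hs0 hs1
    rw [hK, mul_assoc _ ((1 + y⁻¹) ^ 3)]
    gcongr
    linarith
  have hmv (x : ℝ) (hx : x ∈ Set.Icc (0 : ℝ) 1) : ‖heckeTerm s (w + x) - heckeTerm s w‖ ≤ K := by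
    have := (convex_Icc (0 : ℝ) 1).norm_image_sub_le_of_norm_hasDerivWithin_le
      (f := fun x : ℝ => heckeTerm s (w + x))
      (fun x _ => (hasDerivAt_heckeTerm_add s hw0 x).hasDerivWithinAt) hderiv
      (Set.left_mem_Icc.mpr zero_le_one) hx
    simp only [ofReal_zero, add_zero, sub_zero] at this
    refine this.trans (mul_le_of_le_one_right ((norm_nonneg _).trans (hderiv x hx)) ?_)
    rw [Real.norm_of_nonneg hx.1]; exact hx.2
  have hcont : Continuous fun x : ℝ => heckeTerm s (w + x) :=
    continuous_heckeTerm_add_const s hw0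
  have : heckeTerm s w - ∫ x in (0 : ℝ)..1, heckeTerm s (w + x) =
      -∫ x in (0 : ℝ)..1, (heckeTerm s (w + x) - heckeTerm s w) := by
    rw [intervalIntegral.integral_sub (hcont.intervalIntegrable _ _) (by simp)]
    simp
  rw [this, norm_neg]
  have h := intervalIntegral.norm_integral_le_of_norm_le_const (a := (0 : ℝ)) (b := 1) (C := K)
    (f := fun x : ℝ => heckeTerm s (w + x) - heckeTerm s w)
    (fun x hx => hmv x (by
      rw [Set.uIoc_of_le zero_le_one] at hx; exact ⟨hx.1.le, hx.2⟩))
  simpa using h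

/-- At `s = 0` there is an explicit primitive, in a form that telescopes along a row. -/
theorem integral_heckeTerm_zero {w : ℂ} (hw : 0 < w.im) :
    ∫ x in (0 : ℝ)..1, heckeTerm 0 (w + x) = 1 / w - 1 / (w + 1) := by
  have h (x : ℝ) : HasDerivAt (fun x : ℝ => -(w + (x : ℂ))⁻¹) (heckeTerm 0 (w + x)) x := by
    have hx : 0 < (w + (x : ℂ)).im := by simpa using hw
    have h1 : HasDerivAt (fun x : ℝ => w + (x : ℂ)) 1 x :=
      (ofRealCLM.hasDerivAt (x := x)).const_add w
    convert! (h1.fun_inv (ne_zero_of_im_pos hx)).fun_neg using 1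
    rw [heckeTerm_zero]; field_simp
  have hcont : Continuous fun x : ℝ => heckeTerm 0 (w + x) :=
    continuous_heckeTerm_add_const 0 hw
  rw [intervalIntegral.integral_eq_sub_of_hasDerivAt (fun x _ => h x)
    (hcont.intervalIntegrable _ _)]
  simp; ring

/-! ### The integral of Hecke's summand over a horizontal line. -/

section Integral

theorem normSq_ofReal_add_I (v : ℝ) : normSq ((v : ℂ) + I) = 1 + v ^ 2 := by
  simp [normSq_apply]; ring

theorem ofReal_add_I_ne_zero (v : ℝ) : (v : ℂ) + I ≠ 0 :=
  ne_zero_of_im_pos (by simp)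

theorem integrable_heckeTerm_add_I {s : ℝ} (hs : 0 ≤ s) :
    Integrable fun v : ℝ => heckeTerm s (v + I) := by
  have hcont : Continuous fun v : ℝ => heckeTerm s (v + I) := by
    have := (continuous_heckeTerm_add (w := I) (by simp)).comp
      (by fun_prop : Continuous fun x : ℝ => (s, x))
    simpa [Function.comp_def, add_comm] using this
  refine integrable_inv_one_add_sq.mono' hcont.aestronglyMeasurable (ae_of_all _ fun v => ?_)
  rw [heckeTerm, norm_mul, norm_inv, norm_pow, norm_real, ← normSq_eq_norm_sq,
    normSq_ofReal_add_I, Real.norm_of_nonneg (by positivity)]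
  exact mul_le_of_le_one_right (by positivity)
    (Real.rpow_le_one_of_one_le_of_nonpos (by nlinarith) (by linarith))

/-- The integrand remaining after integrating `heckeTerm` by parts. -/
noncomputable def heckeKernel (s v : ℝ) : ℂ :=
  (v : ℂ) * ((v : ℂ) + I)⁻¹ * (((1 + v ^ 2) ^ (-s / 2 - 1) : ℝ) : ℂ)

theorem continuous_heckeKernel : Continuous fun p : ℝ × ℝ => heckeKernel p.1 p.2 := by
  unfold heckeKernel
  refine Continuous.mul (Continuous.mul (by fun_prop) (Continuous.inv₀ (by fun_prop)
    fun p => ofReal_add_I_ne_zero _)) (continuous_ofReal.comp (Continuous.rpow (by fun_prop)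
      (by fun_prop) fun p => Or.inl (by positivity)))

theorem norm_heckeKernel_le {s : ℝ} (hs : 0 ≤ s) (v : ℝ) : ‖heckeKernel s v‖ ≤ (1 + v ^ 2)⁻¹ := by
  have h1 : ‖(v : ℂ) * ((v : ℂ) + I)⁻¹‖ ≤ 1 := by
    rw [norm_mul, norm_inv, ← div_eq_mul_inv]
    refine div_le_one_of_le₀ ?_ (norm_nonneg _)
    have := abs_re_le_norm ((v : ℂ) + I)
    simpa using this
  rw [heckeKernel, norm_mul, norm_real, Real.norm_of_nonneg (by positivity)]
  refine (mul_le_of_le_one_left (by positivity) h1).trans ?_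
  rw [← Real.rpow_neg_one]
  exact Real.rpow_le_rpow_of_exponent_le (by nlinarith) (by linarith)

theorem integrable_heckeKernel {s : ℝ} (hs : 0 ≤ s) : Integrable (heckeKernel s) :=
  integrable_inv_one_add_sq.mono'
    (continuous_heckeKernel.comp (by fun_prop : Continuous fun x : ℝ => (s, x))).aestronglyMeasurable
    (ae_of_all _ (norm_heckeKernel_le hs))

theorem tendsto_inv_ofReal_add_I {l : Filter ℝ} (hl : Tendsto (fun v : ℝ => |v|) l atTop) :
    Tendsto (fun v : ℝ => ‖((v : ℂ) + I)⁻¹‖) l (𝓝 0) := by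
  refine squeeze_zero' (Eventually.of_forall fun _ => norm_nonneg _) ?_ (tendsto_inv_atTop_zero.comp hl)
  filter_upwards [hl.eventually_gt_atTop 0] with v hv
  rw [norm_inv]
  refine inv_anti₀ hv ?_
  simpa using abs_re_le_norm ((v : ℂ) + I)

/-- Integration by parts with the primitive `-(v + i)⁻¹` of `(v + i)⁻²`. It extracts the factor `s`
that will meet the pole of `ζ(1 + s)`. -/
theorem integral_heckeTerm_add_I {s : ℝ} (hs : 0 ≤ s) :
    ∫ v : ℝ, heckeTerm s (v + I) = -(s * ∫ v : ℝ, heckeKernel s v) := by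
  have hderiv (v : ℝ) : HasDerivAt
      (fun v : ℝ => -((v : ℂ) + I)⁻¹ * (((1 + v ^ 2) ^ (-s / 2) : ℝ) : ℂ))
      (heckeTerm s (v + I) + s * heckeKernel s v) v := by
    have h1 : HasDerivAt (fun x : ℝ => (x : ℂ) + I) 1 v :=
      (ofRealCLM.hasDerivAt (x := v)).add_const I
    have h2 := (h1.fun_inv (ofReal_add_I_ne_zero v)).fun_neg
    have h3 : HasDerivAt (fun v : ℝ => 1 + v ^ 2) (2 * v) v := by
      convert! ((hasDerivAt_id v).pow 2).const_add 1 using 1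
      simp
    have h4 := (h3.rpow_const (p := -s / 2) (Or.inl (by positivity))).ofReal_comp
    convert! h2.mul h4 using 1
    rw [heckeTerm, heckeKernel, normSq_ofReal_add_I]
    push_cast
    ring
  have hlim {l : Filter ℝ} (hl : Tendsto (fun v : ℝ => |v|) l atTop) : Tendsto
      (fun v : ℝ => -((v : ℂ) + I)⁻¹ * (((1 + v ^ 2) ^ (-s / 2) : ℝ) : ℂ)) l (𝓝 0) := by
    refine squeeze_zero_norm (fun v => ?_) (tendsto_inv_ofReal_add_I hl)
    rw [norm_mul, norm_neg, norm_real, Real.norm_of_nonneg (by positivity)]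
    exact mul_le_of_le_one_right (by positivity)
      (Real.rpow_le_one_of_one_le_of_nonpos (by nlinarith) (by linarith))
  have h := integral_of_hasDerivAt_of_tendsto hderiv
    ((integrable_heckeTerm_add_I hs).add ((integrable_heckeKernel hs).const_mul (s : ℂ)))
    (hlim tendsto_abs_atBot_atTop) (hlim tendsto_abs_atTop_atTop)
  rw [integral_add (integrable_heckeTerm_add_I hs) ((integrable_heckeKernel hs).const_mul (s : ℂ)),
    integral_const_mul, sub_zero] at h
  exact eq_neg_of_add_eq_zero_left h

/-- The kernel is `v (v - i) / (1 + v²)²`, which has an elementary primitive; only its arctangent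
contributes at infinity. -/
theorem integral_heckeKernel_zero : ∫ v : ℝ, heckeKernel 0 v = Real.pi / 2 := by
  have hderiv (v : ℝ) : HasDerivAt
      (fun v : ℝ => (((Real.arctan v - v * (1 + v ^ 2)⁻¹) / 2 : ℝ) : ℂ) +
        I * ((((1 + v ^ 2)⁻¹ / 2 : ℝ)) : ℂ)) (heckeKernel 0 v) v := by
    have hne : 1 + v ^ 2 ≠ 0 := by positivity
    have h3 : HasDerivAt (fun v : ℝ => 1 + v ^ 2) (2 * v) v := by
      convert! ((hasDerivAt_id v).pow 2).const_add 1 using 1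
      simp
    have h4 := h3.fun_inv hne
    have h5 := (((Real.hasDerivAt_arctan v).sub ((hasDerivAt_id v).mul h4)).div_const 2).ofReal_comp
    have h6 := ((h4.div_const 2).ofReal_comp).const_mul I
    convert! h5.add h6 using 1
    have e : (-0 / 2 - 1 : ℝ) = -1 := by norm_num
    rw [heckeKernel, e, Real.rpow_neg_one]
    have hC : (1 + (v : ℂ) ^ 2) ≠ 0 := by exact_mod_cast hne
    have hfac : ((v : ℂ) + I)⁻¹ = (v - I) * (1 + (v : ℂ) ^ 2)⁻¹ := by
      rw [inv_eq_iff_eq_inv, mul_inv, inv_inv]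
      have h7 : (v : ℂ) - I ≠ 0 := by
        intro h
        have := congrArg Complex.im h
        simp at this
      field_simp
      linear_combination -I_sq
    rw [hfac]
    simp only [id]
    push_cast
    field_simp
    ring
  have hsq {l : Filter ℝ} (hl : Tendsto (fun v : ℝ => |v|) l atTop) :
      Tendsto (fun v : ℝ => (1 + v ^ 2)⁻¹) l (𝓝 0) := by
    have h1 : Tendsto (fun v : ℝ => 1 + v ^ 2) l atTop := by
      refine tendsto_atTop_mono (fun v => ?_) hl
      nlinarith [sq_abs v, sq_nonneg (|v| - 1), abs_nonneg v]
    exact tendsto_inv_atTop_zero.comp h1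
  have hlin {l : Filter ℝ} (hl : Tendsto (fun v : ℝ => |v|) l atTop) :
      Tendsto (fun v : ℝ => v * (1 + v ^ 2)⁻¹) l (𝓝 0) := by
    refine squeeze_zero_norm' ?_ (tendsto_inv_atTop_zero.comp hl)
    filter_upwards [hl.eventually_gt_atTop 0] with v hv
    rw [norm_mul, norm_inv, Real.norm_eq_abs, Real.norm_of_nonneg (by positivity : 0 ≤ 1 + v ^ 2),
      Function.comp_apply, ← div_eq_mul_inv, div_le_iff₀ (by positivity), ← sq_abs]
    field_simp
    nlinarith
  have hlim {l : Filter ℝ} (hl : Tendsto (fun v : ℝ => |v|) l atTop) {a : ℝ}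
      (ha : Tendsto Real.arctan l (𝓝 a)) : Tendsto
      (fun v : ℝ => (((Real.arctan v - v * (1 + v ^ 2)⁻¹) / 2 : ℝ) : ℂ) +
        I * ((((1 + v ^ 2)⁻¹ / 2 : ℝ)) : ℂ)) l (𝓝 (((a - 0) / 2 : ℝ) + I * ((0 / 2 : ℝ) : ℂ))) :=
    ((continuous_ofReal.tendsto _).comp ((ha.sub (hlin hl)).div_const 2)).add
      (((continuous_ofReal.tendsto _).comp ((hsq hl).div_const 2)).const_mul I)
  rw [integral_of_hasDerivAt_of_tendsto hderiv (integrable_heckeKernel le_rfl)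
    (hlim tendsto_abs_atBot_atTop (tendsto_nhds_of_tendsto_nhdsWithin Real.tendsto_arctan_atBot))
    (hlim tendsto_abs_atTop_atTop (tendsto_nhds_of_tendsto_nhdsWithin Real.tendsto_arctan_atTop))]
  push_cast
  ring

theorem tendsto_integral_heckeKernel :
    Tendsto (fun s : ℝ => ∫ v : ℝ, heckeKernel s v) (𝓝[>] 0) (𝓝 (Real.pi / 2)) := by
  rw [← integral_heckeKernel_zero]
  refine tendsto_integral_filter_of_dominated_convergence (fun v => (1 + v ^ 2)⁻¹) ?_ ?_
    integrable_inv_one_add_sq ?_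
  · filter_upwards [self_mem_nhdsWithin] with s hs
    exact (integrable_heckeKernel (le_of_lt hs)).aestronglyMeasurable
  · filter_upwards [self_mem_nhdsWithin] with s hs
    exact ae_of_all _ (norm_heckeKernel_le (le_of_lt hs))
  · refine ae_of_all _ fun v => ?_
    have h : Continuous fun s : ℝ => heckeKernel s v :=
      continuous_heckeKernel.comp (by fun_prop : Continuous fun s : ℝ => (s, v))
    exact (h.tendsto 0).mono_left nhdsWithin_le_nhds

/-- Homogeneity: scaling by `Im w` moves every horizontal line to the one through `i`. -/
theorem heckeTerm_add_eq {s : ℝ} {w : ℂ} (hw : 0 < w.im) (x : ℝ) :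
    heckeTerm s (w + x) =
      ((w.im ^ (-(2 + s)) : ℝ) : ℂ) * heckeTerm s (((x + w.re) / w.im : ℝ) + I) := by
  have hb : (w.im : ℂ) ≠ 0 := by exact_mod_cast hw.ne'
  have h1 : w + x = (w.im : ℂ) * ((((x + w.re) / w.im : ℝ) : ℂ) + I) := by
    push_cast
    conv_lhs => rw [← re_add_im w]
    field_simp
    ring
  rw [heckeTerm, h1, heckeTerm, normSq_mul, normSq_ofReal, Real.mul_rpow (by positivity)
    (normSq_nonneg _), mul_pow, mul_inv]
  have h2 : w.im ^ (-(2 + s)) = (w.im ^ 2)⁻¹ * (w.im * w.im) ^ (-s / 2) := by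
    rw [neg_add, Real.rpow_add hw, Real.rpow_neg hw.le, ← sq, ← Real.rpow_natCast,
      ← Real.rpow_mul hw.le]
    congr 2
    all_goals (push_cast; ring)
  rw [h2]
  push_cast
  ring

theorem integrable_heckeTerm_add {s : ℝ} (hs : 0 ≤ s) {w : ℂ} (hw : 0 < w.im) :
    Integrable fun x : ℝ => heckeTerm s (w + x) := by
  simp only [heckeTerm_add_eq hw]
  exact (((integrable_heckeTerm_add_I hs).comp_div hw.ne').comp_add_right w.re).const_mul _

theorem integral_heckeTerm_add {s : ℝ} {w : ℂ} (hw : 0 < w.im) :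
    ∫ x : ℝ, heckeTerm s (w + x) =
      ((w.im ^ (-(1 + s)) : ℝ) : ℂ) * ∫ v : ℝ, heckeTerm s (v + I) := by
  simp only [heckeTerm_add_eq hw]
  rw [integral_const_mul, integral_add_right_eq_self
    (fun x : ℝ => heckeTerm s ((x / w.im : ℝ) + I)) w.re,
    Measure.integral_comp_div (fun v : ℝ => heckeTerm s (v + I)), abs_of_pos hw, real_smul,
    ← mul_assoc, ← ofReal_mul]
  congr 2
  rw [show -(1 + s) = -(2 + s) + 1 by ring, Real.rpow_add hw, Real.rpow_one]

end Integral

end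

/-! ### Hecke's limit formula in weight two. -/

section

open Complex Filter Topology MeasureTheory

section HeckeLimit

variable (τ : UpperHalfPlane)

/-- The lattice points in the open upper half plane, indexed by `ℕ × ℤ`. -/
noncomputable def upperPt (x : ℕ × ℤ) : ℂ := latticePt τ ((x.1 : ℤ) + 1, x.2)

theorem upperPt_eq (x : ℕ × ℤ) : upperPt τ x = ((x.1 : ℂ) + 1) * τ + x.2 := by
  simp [upperPt, latticePt]

theorem upperPt_im (x : ℕ × ℤ) : (upperPt τ x).im = ((x.1 : ℝ) + 1) * τ.im := by
  have : ((x.1 : ℂ) + 1) = (((x.1 : ℝ) + 1 : ℝ) : ℂ) := by push_cast; rfl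
  rw [upperPt_eq, this, add_im, im_ofReal_mul]
  simp

theorem im_le_upperPt_im (x : ℕ × ℤ) : τ.im ≤ (upperPt τ x).im := by
  rw [upperPt_im]
  nlinarith [τ.im_pos, (Nat.cast_nonneg x.1 : (0 : ℝ) ≤ x.1)]

theorem upperPt_im_pos (x : ℕ × ℤ) : 0 < (upperPt τ x).im :=
  τ.im_pos.trans_le (im_le_upperPt_im τ x)

theorem upperPt_ne_zero (x : ℕ × ℤ) : upperPt τ x ≠ 0 := ne_zero_of_im_pos (upperPt_im_pos τ x)

theorem upperPt_add (m : ℕ) (n : ℤ) (x : ℝ) :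
    upperPt τ (m, n) + x = upperPt τ (m, 0) + ((x + n : ℝ) : ℂ) := by
  simp only [upperPt_eq]; push_cast; ring

theorem summable_norm_upperPt_rpow {r : ℝ} (hr : 2 < r) :
    Summable fun x : ℕ × ℤ => ‖upperPt τ x‖ ^ (-r) := by
  refine (summable_norm_latticePt_rpow τ hr).comp_injective
    (i := fun x : ℕ × ℤ => ((x.1 : ℤ) + 1, x.2)) ?_
  rintro ⟨a, b⟩ ⟨c, d⟩ h
  simpa using h

theorem summable_heckeTerm_upperPt {s : ℝ} (hs : 0 < s) :
    Summable fun x : ℕ × ℤ => heckeTerm s (upperPt τ x) := by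
  refine Summable.of_norm ?_
  simp only [norm_heckeTerm s (upperPt_ne_zero τ _)]
  exact summable_norm_upperPt_rpow τ (by linarith)

/-- The difference between a term of Hecke's series and its integral over a unit interval. -/
noncomputable def heckeDiff (s : ℝ) (x : ℕ × ℤ) : ℂ :=
  heckeTerm s (upperPt τ x) - ∫ t in (0 : ℝ)..1, heckeTerm s (upperPt τ x + t)

theorem exists_heckeDiff_bound : ∃ C : ℝ, ∀ s : ℝ, 0 ≤ s → s ≤ 1 → ∀ x,
    ‖heckeDiff τ s x‖ ≤ C * ‖upperPt τ x‖ ^ (-3 : ℝ) := by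
  obtain ⟨C, hC⟩ := exists_norm_heckeTerm_sub_integral_le τ.im_pos
  exact ⟨C, fun s h0 h1 x => hC s h0 h1 _ (im_le_upperPt_im τ x)⟩

theorem summable_heckeDiff {s : ℝ} (h0 : 0 ≤ s) (h1 : s ≤ 1) : Summable (heckeDiff τ s) := by
  obtain ⟨C, hC⟩ := exists_heckeDiff_bound τ
  exact Summable.of_norm_bounded ((summable_norm_upperPt_rpow τ (by norm_num)).mul_left C)
    (hC s h0 h1)

theorem tendsto_heckeDiff (x : ℕ × ℤ) :
    Tendsto (fun s => heckeDiff τ s x) (𝓝[>] 0) (𝓝 (heckeDiff τ 0 x)) := by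
  have hc := continuous_heckeTerm_add (upperPt_im_pos τ x)
  have h1 : Continuous fun s : ℝ => heckeTerm s (upperPt τ x) := by
    simpa [Function.comp_def] using hc.comp (Continuous.prodMk_left (X := ℝ) (Y := ℝ) 0)
  have h2 : Continuous fun s : ℝ => ∫ t in (0 : ℝ)..1, heckeTerm s (upperPt τ x + t) :=
    intervalIntegral.continuous_parametric_intervalIntegral_of_continuous' hc 0 1
  exact ((h1.sub h2).tendsto 0).mono_left nhdsWithin_le_nhds

/-- The dominating series with exponent `3` reaches `s = 0`, where the Eisenstein series itself is
no longer absolutely convergent. -/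
theorem tendsto_tsum_heckeDiff :
    Tendsto (fun s => ∑' x, heckeDiff τ s x) (𝓝[>] 0) (𝓝 (∑' x, heckeDiff τ 0 x)) := by
  obtain ⟨C, hC⟩ := exists_heckeDiff_bound τ
  refine tendsto_tsum_of_dominated_convergence
    ((summable_norm_upperPt_rpow τ (r := 3) (by norm_num)).mul_left C) (tendsto_heckeDiff τ) ?_
  filter_upwards [Ioo_mem_nhdsGT (zero_lt_one' ℝ)] with s hs
  exact hC s hs.1.le hs.2.le

theorem summable_inv_upperPt_sq (m : ℕ) : Summable fun n : ℤ => ((upperPt τ (m, n)) ^ 2)⁻¹ := by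
  simpa [upperPt_eq, zpow_ofNat] using
    EisensteinSeries.linear_right_summable (τ : ℂ) (m + 1) (k := 2) le_rfl

/-- Along a row the integrals telescope to zero, so subtracting them leaves the row sum unchanged.
-/
theorem hasSum_heckeDiff_zero (m : ℕ) :
    HasSum (fun n : ℤ => heckeDiff τ 0 (m, n)) (∑' n : ℤ, ((upperPt τ (m, n)) ^ 2)⁻¹) := by
  have h1 := EisensteinSeries.summable_right_one_div_linear_sub_one_div_linear_succ τ (m + 1)
  have h2 := EisensteinSeries.tsum_symmetricIco_linear_sub_linear_add_one_eq_zero τ (m + 1)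
  rw [tsum_eq_of_summable_unconditional h1] at h2
  have h3 := (summable_inv_upperPt_sq τ m).hasSum.sub h1.hasSum
  rw [h2, sub_zero] at h3
  refine h3.congr_fun fun n => ?_
  rw [heckeDiff, heckeTerm_zero, integral_heckeTerm_zero (upperPt_im_pos τ _)]
  simp [upperPt_eq]

/-- The part of the Eisenstein series of weight two that comes from the rows `m ≥ 1`. -/
noncomputable def eisensteinRows : ℂ := ∑' (m : ℕ) (n : ℤ), ((upperPt τ (m, n)) ^ 2)⁻¹

/-- The outer sum converges because it is the absolutely convergent double sum of the differences,
summed by rows. -/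
theorem hasSum_eisensteinRows :
    HasSum (fun m : ℕ => ∑' n : ℤ, ((upperPt τ (m, n)) ^ 2)⁻¹) (eisensteinRows τ) :=
  ((summable_heckeDiff τ le_rfl zero_le_one).hasSum.prod_fiberwise
    (hasSum_heckeDiff_zero τ)).summable.hasSum

theorem tsum_heckeDiff_zero : ∑' x, heckeDiff τ 0 x = eisensteinRows τ :=
  ((summable_heckeDiff τ le_rfl zero_le_one).hasSum.prod_fiberwise
    (hasSum_heckeDiff_zero τ)).tsum_eq.symm

/-- The unit intervals of a row tile the real line, and by scaling row `m` contributes a multiple of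
`(m + 1)^(-(1 + s))`. -/
theorem tsum_integral_heckeTerm {s : ℝ} (h0 : 0 < s) (h1 : s ≤ 1) :
    ∑' x : ℕ × ℤ, ∫ t in (0 : ℝ)..1, heckeTerm s (upperPt τ x + t) =
      (τ.im ^ (-(1 + s)) : ℝ) * -(s * (∑' n : ℕ, 1 / (n : ℝ) ^ (1 + s) : ℝ) *
        ∫ v : ℝ, heckeKernel s v) := by
  have hsum : Summable fun x : ℕ × ℤ => ∫ t in (0 : ℝ)..1, heckeTerm s (upperPt τ x + t) := by
    refine ((summable_heckeTerm_upperPt τ h0).sub (summable_heckeDiff τ h0.le h1)).congr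
      fun x => ?_
    rw [heckeDiff]; ring
  have hrow (m : ℕ) : HasSum (fun n : ℤ => ∫ t in (0 : ℝ)..1, heckeTerm s (upperPt τ (m, n) + t))
      (((((m : ℝ) + 1) ^ (-(1 + s)) : ℝ) : ℂ) * ((τ.im ^ (-(1 + s)) : ℝ) *
        -(s * ∫ v : ℝ, heckeKernel s v))) := by
    have := (integrable_heckeTerm_add h0.le (upperPt_im_pos τ (m, 0))).hasSum_intervalIntegral_comp_add_int
    rw [integral_heckeTerm_add (upperPt_im_pos τ (m, 0)), integral_heckeTerm_add_I h0.le, upperPt_im,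
      Real.mul_rpow (by positivity) τ.im_pos.le, ofReal_mul, mul_assoc] at this
    simpa only [← upperPt_add] using this
  rw [← (hsum.hasSum.prod_fiberwise hrow).tsum_eq, tsum_mul_right, ← ofReal_tsum]
  -- The term `n = 0` on the left is `1 / 0 = 0`.
  have hz : ∑' n : ℕ, 1 / (n : ℝ) ^ (1 + s) = ∑' m : ℕ, ((m : ℝ) + 1) ^ (-(1 + s)) := by
    rw [(Real.summable_one_div_nat_rpow.mpr (by linarith)).tsum_eq_zero_add]
    rw [Nat.cast_zero, Real.zero_rpow (by linarith), div_zero, zero_add]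
    refine tsum_congr fun m => ?_
    rw [Real.rpow_neg (by positivity), one_div]
    push_cast; rfl
  rw [hz]
  push_cast
  ring

/-- Hecke's limit formula for the Eisenstein series of weight two. -/
theorem tendsto_tsum_heckeTerm :
    Tendsto (fun s => ∑' x, heckeTerm s (upperPt τ x)) (𝓝[>] 0)
      (𝓝 (eisensteinRows τ - Real.pi / (2 * τ.im))) := by
  have hz : Tendsto (fun s : ℝ => s * ∑' n : ℕ, 1 / (n : ℝ) ^ (1 + s)) (𝓝[>] 0) (𝓝 1) := by
    have h : Tendsto (fun s : ℝ => 1 + s) (𝓝[>] 0) (𝓝[>] 1) := by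
      refine tendsto_nhdsWithin_iff.mpr ⟨?_, ?_⟩
      · have : Tendsto (fun s : ℝ => 1 + s) (𝓝 0) (𝓝 (1 + 0)) := by
          exact tendsto_const_nhds.add tendsto_id
        rw [add_zero] at this
        exact this.mono_left nhdsWithin_le_nhds
      · filter_upwards [self_mem_nhdsWithin] with s hs
        simpa using hs
    refine (tendsto_sub_mul_tsum_nat_rpow.comp h).congr fun s => ?_
    simp
  have hy : Tendsto (fun s : ℝ => τ.im ^ (-(1 + s))) (𝓝[>] 0) (𝓝 (τ.im)⁻¹) := by
    have h : Continuous fun s : ℝ => τ.im ^ (-(1 + s)) :=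
      Continuous.rpow continuous_const (by fun_prop) fun _ => Or.inl τ.im_pos.ne'
    have := (h.tendsto 0).mono_left (nhdsWithin_le_nhds (s := Set.Ioi 0))
    rwa [add_zero, Real.rpow_neg_one] at this
  -- The differences give the row sum. In the integrals `s ζ(1 + s) → 1` and the kernel integral
  -- tends to `π / 2`, which leaves `-π / (2 Im τ)`.
  have hlim := (tendsto_tsum_heckeDiff τ).add
    (((continuous_ofReal.tendsto _).comp hy).mul
      ((((continuous_ofReal.tendsto _).comp hz).mul tendsto_integral_heckeKernel).neg))
  rw [tsum_heckeDiff_zero] at hlim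
  have hval : eisensteinRows τ + ((τ.im)⁻¹ : ℝ) * -((1 : ℝ) * ((Real.pi : ℂ) / 2)) =
      eisensteinRows τ - Real.pi / (2 * τ.im) := by
    have : (τ.im : ℂ) ≠ 0 := by exact_mod_cast τ.im_pos.ne'
    push_cast
    field_simp
    ring
  rw [hval] at hlim
  refine hlim.congr' ?_
  filter_upwards [Ioo_mem_nhdsGT (zero_lt_one' ℝ)] with s hs
  have hsum : Summable fun x : ℕ × ℤ => ∫ t in (0 : ℝ)..1, heckeTerm s (upperPt τ x + t) := by
    refine ((summable_heckeTerm_upperPt τ hs.1).sub (summable_heckeDiff τ hs.1.le hs.2.le)).congr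
      fun x => ?_
    rw [heckeDiff]; ring
  have := tsum_integral_heckeTerm τ hs.1 hs.2.le
  simp only [Function.comp_apply, ofReal_mul]
  rw [← this, ← (summable_heckeDiff τ hs.1.le hs.2.le).tsum_add hsum]
  exact tsum_congr fun x => by rw [heckeDiff]; ring

end HeckeLimit

end

/-! ### Index sets: lattice points and coprime pairs up to sign. -/

section

open Complex Filter Topology

section Indices

/-- Representatives of the nonzero pairs of integers up to sign. -/
abbrev HalfLattice : Type := {p : ℤ × ℤ // 0 < p.1 ∨ (p.1 = 0 ∧ 0 < p.2)}

/-- Representatives of the coprime pairs of integers up to sign. -/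
abbrev PrimHalf : Type :=
  {p : ℤ × ℤ // Int.gcd p.1 p.2 = 1 ∧ (0 < p.1 ∨ (p.1 = 0 ∧ 0 < p.2))}

theorem HalfLattice.ne_zero (p : HalfLattice) : p.1 ≠ 0 := by
  rcases p with ⟨⟨a, b⟩, h⟩
  intro h0
  simp only [Prod.mk_eq_zero] at h0
  simp only at h
  omega

theorem PrimHalf.ne_zero (p : PrimHalf) : p.1 ≠ 0 := HalfLattice.ne_zero ⟨p.1, p.2.2⟩

/-- A nonzero pair of integers up to sign is a positive multiple of a coprime pair. -/
noncomputable def primHalfProdEquiv : PrimHalf × ℕ ≃ HalfLattice :=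
  Equiv.ofBijective
    (fun x => ⟨(((x.2 : ℤ) + 1) * x.1.1.1, ((x.2 : ℤ) + 1) * x.1.1.2), by
      rcases x.1.2.2 with h | h
      · exact Or.inl (by positivity)
      · exact Or.inr ⟨by simp [h.1], mul_pos (by positivity) h.2⟩⟩) (by
    constructor
    · rintro ⟨⟨⟨a, b⟩, h1, h2⟩, k⟩ ⟨⟨⟨c, d⟩, h3, h4⟩, l⟩ h
      have h5 := congrArg Subtype.val h
      simp only [Prod.mk.injEq] at h5 h1 h3
      have h6 : Int.gcd (((k : ℤ) + 1) * a) (((k : ℤ) + 1) * b) =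
        Int.gcd (((l : ℤ) + 1) * c) (((l : ℤ) + 1) * d) := by rw [h5.1, h5.2]
      rw [Int.gcd_mul_left, Int.gcd_mul_left, h1, h3] at h6
      have h7 : k = l := by omega
      subst h7
      have hk : (k : ℤ) + 1 ≠ 0 := by positivity
      have h8 := mul_left_cancel₀ hk h5.1
      have h9 := mul_left_cancel₀ hk h5.2
      subst h8 h9
      rfl
    · rintro ⟨⟨a, b⟩, h⟩
      simp only at h
      have hg : 0 < Int.gcd a b := Int.gcd_pos_iff.mpr (by omega)
      obtain ⟨g, hg'⟩ := Nat.exists_eq_add_of_lt hg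
      rw [zero_add] at hg'
      obtain ⟨a', ha⟩ := Int.gcd_dvd_left a b
      obtain ⟨b', hb⟩ := Int.gcd_dvd_right a b
      have hgz : (Int.gcd a b : ℤ) = (g : ℤ) + 1 := by rw [hg']; push_cast; ring
      have hcop : Int.gcd a' b' = 1 := by
        have h1 := Int.gcd_mul_left (Int.gcd a b : ℤ) a' b'
        rw [← ha, ← hb, Int.natAbs_natCast] at h1
        exact Nat.eq_of_mul_eq_mul_left hg (by rw [← h1, mul_one])
      rw [hgz] at ha hb
      have hpos : (0 : ℤ) < (g : ℤ) + 1 := by positivity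
      refine ⟨⟨⟨(a', b'), hcop, ?_⟩, g⟩, Subtype.ext (Prod.ext ha.symm hb.symm)⟩
      rcases h with h | ⟨h, h'⟩
      · exact Or.inl (pos_of_mul_pos_right (ha ▸ h) hpos.le)
      · refine Or.inr ⟨?_, pos_of_mul_pos_right (hb ▸ h') hpos.le⟩
        rw [h] at ha
        exact (mul_eq_zero.mp ha.symm).resolve_left hpos.ne')

/-- The row `m = 0` and the rows `m ≥ 1` of the half lattice. -/
def sumEquivHalfLattice : ℕ ⊕ (ℕ × ℤ) ≃ HalfLattice where
  toFun
    | Sum.inl n => ⟨(0, (n : ℤ) + 1), Or.inr ⟨rfl, by positivity⟩⟩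
    | Sum.inr y => ⟨((y.1 : ℤ) + 1, y.2), Or.inl (by positivity)⟩
  invFun p := if p.1.1 = 0 then Sum.inl (p.1.2 - 1).toNat else Sum.inr ((p.1.1 - 1).toNat, p.1.2)
  left_inv := by
    rintro (a | ⟨a, b⟩)
    · simp
    · have : (a : ℤ) + 1 ≠ 0 := by omega
      simp [this]
  right_inv := by
    rintro ⟨⟨a, b⟩, h⟩
    simp only at h
    by_cases ha : a = 0
    · simp only [ha, if_true, Subtype.mk.injEq, Prod.mk.injEq, true_and]; omega
    · simp only [ha, if_false, Subtype.mk.injEq, Prod.mk.injEq, and_true]; omega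

end Indices

/-! ### Lattice points and the parametrization of the set `X`. -/

section Lattice

variable (τ : UpperHalfPlane)

theorem latticePt_ne_zero {p : ℤ × ℤ} (hp : p ≠ 0) : latticePt τ p ≠ 0 := by
  have := UpperHalfPlane.linear_ne_zero (cd := ![(p.1 : ℝ), (p.2 : ℝ)]) τ (by
    intro h
    have h0 := congrFun h 0
    have h1 := congrFun h 1
    simp at h0 h1
    exact hp (Prod.ext h0 h1))
  simpa [latticePt] using this

theorem exists_le_norm_latticePt : ∃ δ : ℝ, 0 < δ ∧ ∀ p : ℤ × ℤ, p ≠ 0 → δ ≤ ‖latticePt τ p‖ := by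
  refine ⟨EisensteinSeries.r τ, EisensteinSeries.r_pos τ, fun p hp => ?_⟩
  rcases eq_or_ne p.1 0 with h | h
  · have h2 : p.2 ≠ 0 := fun h2 => hp (Prod.ext h h2)
    have := EisensteinSeries.auxbound2 τ (p.1 : ℝ) (d := (p.2 : ℝ)) (by
      rw [one_le_sq_iff_one_le_abs]; exact_mod_cast Int.one_le_abs h2)
    simpa [latticePt] using this
  · have := EisensteinSeries.auxbound1 τ (c := (p.1 : ℝ)) (p.2 : ℝ) (by
      rw [one_le_sq_iff_one_le_abs]; exact_mod_cast Int.one_le_abs h)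
    simpa [latticePt] using this

theorem latticePt_primHalfProdEquiv (x : PrimHalf × ℕ) :
    latticePt τ (primHalfProdEquiv x).1 = ((x.2 : ℂ) + 1) * latticePt τ x.1.1 := by
  have : (primHalfProdEquiv x).1 = (((x.2 : ℤ) + 1) * x.1.1.1, ((x.2 : ℤ) + 1) * x.1.1.2) := rfl
  rw [this]
  simp only [latticePt]
  push_cast
  ring

theorem latticePt_sumEquiv_inl (n : ℕ) :
    latticePt τ (sumEquivHalfLattice (Sum.inl n)).1 = (n : ℂ) + 1 := by
  simp [latticePt, sumEquivHalfLattice]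

theorem latticePt_sumEquiv_inr (y : ℕ × ℤ) :
    latticePt τ (sumEquivHalfLattice (Sum.inr y)).1 = upperPt τ y := by
  simp [latticePt, sumEquivHalfLattice, upperPt]

theorem heckeTerm_eq_one_div (s : ℝ) (w : ℂ) :
    heckeTerm s w = 1 / (w ^ 2 * ((‖w‖ ^ s : ℝ) : ℂ)) := by
  rw [heckeTerm, normSq_rpow, Real.rpow_neg (norm_nonneg _), one_div, mul_inv, ofReal_inv]

theorem latticePt_injective : Function.Injective (latticePt τ) := by
  intro p q h
  by_contra hne
  have := latticePt_ne_zero τ (sub_ne_zero.mpr hne)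
  apply this
  have : latticePt τ (p - q) = latticePt τ p - latticePt τ q := by
    simp [latticePt]; ring
  rw [this, h, sub_self]

theorem latticePt_neg (p : ℤ × ℤ) : latticePt τ (-p) = -latticePt τ p := by
  simp [latticePt]; ring

theorem heckeTerm_neg (s : ℝ) (w : ℂ) : heckeTerm s (-w) = heckeTerm s w := by
  simp [heckeTerm]

/-- The norm of the term determines `|w|`, and then the real factors cancel. Hence a set without
multiplicities merges only opposite pairs. -/
theorem sq_eq_sq_of_heckeTerm_eq {s : ℝ} (hs : 0 < s) {v w : ℂ} (hv : v ≠ 0) (hw : w ≠ 0)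
    (h : heckeTerm s v = heckeTerm s w) : v ^ 2 = w ^ 2 := by
  have hn : ‖v‖ = ‖w‖ := by
    have := congrArg norm h
    rw [norm_heckeTerm s hv, norm_heckeTerm s hw] at this
    exact (Real.rpow_left_inj (norm_nonneg _) (norm_nonneg _) (by linarith)).mp this
  rw [heckeTerm, heckeTerm, normSq_eq_norm_sq, normSq_eq_norm_sq, hn] at h
  have h0 : (((‖w‖ ^ 2) ^ (-s / 2) : ℝ) : ℂ) ≠ 0 := by
    have : 0 < ‖w‖ := norm_pos_iff.mpr hw
    exact_mod_cast (by positivity : (‖w‖ ^ 2) ^ (-s / 2) ≠ 0)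
  exact inv_injective (mul_right_cancel₀ h0 h)

/-- The elements of `ahatX τ s` correspond to the coprime pairs up to sign. -/
noncomputable def ahatXEquiv {s : ℝ} (hs : 0 < s) : PrimHalf ≃ ahatX τ s :=
  Equiv.ofBijective
    (fun p => ⟨heckeTerm s (latticePt τ p.1), p.1.1, p.1.2, p.2.1, heckeTerm_eq_one_div _ _⟩) (by
    constructor
    · intro p q h
      have h1 := sq_eq_sq_of_heckeTerm_eq hs (latticePt_ne_zero τ p.ne_zero)
        (latticePt_ne_zero τ q.ne_zero) (congrArg Subtype.val h)
      rcases sq_eq_sq_iff_eq_or_eq_neg.mp h1 with h2 | h2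
      · exact Subtype.ext (latticePt_injective τ h2)
      · rw [← latticePt_neg] at h2
        have h3 := latticePt_injective τ h2
        rcases p with ⟨⟨a, b⟩, _, hp⟩
        rcases q with ⟨⟨c, d⟩, _, hq⟩
        simp only [Prod.neg_mk, Prod.mk.injEq] at h3 hp hq
        omega
    · rintro ⟨x, m, n, hg, hx⟩
      have hx' : x = heckeTerm s (latticePt τ (m, n)) := by
        rw [heckeTerm_eq_one_div]; exact hx
      by_cases hpos : 0 < m ∨ (m = 0 ∧ 0 < n)
      · exact ⟨⟨(m, n), hg, hpos⟩, Subtype.ext hx'.symm⟩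
      · have hne : ¬ (m = 0 ∧ n = 0) := by
          rintro ⟨rfl, rfl⟩
          simp at hg
        refine ⟨⟨-(m, n), by simpa using hg, ?_⟩, Subtype.ext ?_⟩
        · simp only [Prod.neg_mk]; omega
        · exact (by rw [latticePt_neg, heckeTerm_neg] :
            heckeTerm s (latticePt τ (-(m, n))) = heckeTerm s (latticePt τ (m, n))).trans hx'.symm)

theorem ahatXEquiv_apply {s : ℝ} (hs : 0 < s) (p : PrimHalf) :
    (ahatXEquiv τ hs p : ℂ) = heckeTerm s (latticePt τ p.1) := rfl

end Lattice

end

/-! ### Weierstrass factors and the sine product. -/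

section

open Complex Filter Topology

section Weierstrass

/-- The Weierstrass elementary factor of genus one. -/
noncomputable def weierstrassFactor (w : ℂ) : ℂ := (1 - w) * cexp w

theorem weierstrassFactor_eq_zero_iff {w : ℂ} : weierstrassFactor w = 0 ↔ w = 1 := by
  simp [weierstrassFactor, Complex.exp_ne_zero, sub_eq_zero, eq_comm (a := w)]

/-- The exponential cancels the linear term. A disc of any radius is allowed because the arguments
are bounded but not small; beyond the unit disc mere boundedness suffices. -/
theorem exists_norm_weierstrassFactor_sub_one_le (R : ℝ) : ∃ C : ℝ, 0 ≤ C ∧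
    ∀ w : ℂ, ‖w‖ ≤ R → ‖weierstrassFactor w - 1‖ ≤ C * ‖w‖ ^ 2 := by
  refine ⟨3 + ((1 + |R|) * Real.exp |R| + 1), by positivity, fun w hw => ?_⟩
  have hR : ‖w‖ ≤ |R| := hw.trans (le_abs_self R)
  rcases le_total ‖w‖ 1 with h | h
  · have h1 := norm_exp_sub_one_sub_id_le h
    have h2 := norm_exp_sub_one_le h
    have e : weierstrassFactor w - 1 = (cexp w - 1 - w) - w * (cexp w - 1) := by
      rw [weierstrassFactor]; ring
    calc ‖weierstrassFactor w - 1‖ ≤ ‖w‖ ^ 2 + ‖w‖ * (2 * ‖w‖) := by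
          rw [e]
          refine (norm_sub_le _ _).trans (add_le_add h1 ?_)
          rw [norm_mul]
          gcongr
      _ = 3 * ‖w‖ ^ 2 := by ring
      _ ≤ _ := by gcongr; linarith [show 0 ≤ (1 + |R|) * Real.exp |R| + 1 by positivity]
  · have h1 : ‖weierstrassFactor w - 1‖ ≤ (1 + |R|) * Real.exp |R| + 1 := by
      refine (norm_sub_le _ _).trans (add_le_add ?_ (by simp))
      rw [weierstrassFactor, norm_mul]
      refine mul_le_mul ((norm_sub_le _ _).trans (by simpa using hR)) ?_ (norm_nonneg _)
        (by positivity)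
      exact (norm_exp_le_exp_norm w).trans (Real.exp_le_exp.mpr hR)
    have h2 : 1 ≤ ‖w‖ ^ 2 := one_le_pow₀ h
    have h3 : 0 ≤ (1 + |R|) * Real.exp |R| + 1 := by positivity
    nlinarith

theorem continuous_weierstrassFactor : Continuous weierstrassFactor := by
  unfold weierstrassFactor; fun_prop

end Weierstrass

section Sine

/-- The zeta value `ζ(2 + s)`. -/
noncomputable def zetaSum (s : ℝ) : ℝ := ∑' k : ℕ, ((k : ℝ) + 1) ^ (-(2 + s))

theorem summable_zetaSum {s : ℝ} (hs : 0 ≤ s) :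
    Summable fun k : ℕ => ((k : ℝ) + 1) ^ (-(2 + s)) := by
  have h := (summable_nat_add_iff 1).mpr
    (Real.summable_nat_rpow (p := -(2 + s)) |>.mpr (by linarith))
  simpa using h

theorem zetaSum_zero_pos : 0 < zetaSum 0 :=
  (summable_zetaSum le_rfl).tsum_pos (fun k => by positivity) 0 (by simp)

theorem tendsto_zetaSum : Tendsto zetaSum (𝓝[>] 0) (𝓝 (zetaSum 0)) := by
  refine tendsto_tsum_of_dominated_convergence (summable_zetaSum le_rfl) (fun k => ?_) ?_
  · have h : Continuous fun s : ℝ => ((k : ℝ) + 1) ^ (-(2 + s)) :=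
      Continuous.rpow continuous_const (by fun_prop) fun _ => Or.inl (by positivity)
    exact (h.tendsto 0).mono_left nhdsWithin_le_nhds
  · filter_upwards [self_mem_nhdsWithin] with s hs k
    rw [Real.norm_of_nonneg (by positivity)]
    exact Real.rpow_le_rpow_of_exponent_le (by linarith [(Nat.cast_nonneg k : (0 : ℝ) ≤ k)])
      (by linarith [Set.mem_Ioi.mp hs])

theorem hasSum_div_sq (w : ℂ) :
    HasSum (fun k : ℕ => w / ((k : ℂ) + 1) ^ 2) (zetaSum 0 * w) := by
  have h := (hasSum_ofReal.mpr (summable_zetaSum le_rfl).hasSum).mul_right w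
  refine h.congr_fun fun k => ?_
  have : ((k : ℝ) + 1) ^ (-(2 + 0) : ℝ) = (((k : ℝ) + 1) ^ 2)⁻¹ := by
    rw [add_zero, Real.rpow_neg (by positivity)]; norm_num
  rw [this]
  push_cast
  rw [div_eq_mul_inv, mul_comm]

/-- The entire function `sin (π √w) / (π √w)` as an infinite product. -/
noncomputable def sineProd (w : ℂ) : ℂ := ∏' k : ℕ, (1 - w / ((k : ℂ) + 1) ^ 2)

theorem hasProd_sineProd (w : ℂ) :
    HasProd (fun k : ℕ => 1 - w / ((k : ℂ) + 1) ^ 2) (sineProd w) := by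
  have := multipliable_one_add_of_summable (f := fun k : ℕ => -(w / ((k : ℂ) + 1) ^ 2))
    (by simpa only [norm_neg] using (hasSum_div_sq w).summable.norm)
  simpa only [sineProd, ← sub_eq_add_neg] using this.hasProd

theorem sineProd_sq {y : ℂ} (hy : y ≠ 0) : sineProd (y ^ 2) = sin (Real.pi * y) / (Real.pi * y) := by
  have hne : (Real.pi : ℂ) * y ≠ 0 := mul_ne_zero (by exact_mod_cast Real.pi_ne_zero) hy
  have h1 := (hasProd_sineProd (y ^ 2)).tendsto_prod_nat.const_mul ((Real.pi : ℂ) * y)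
  have h2 := tendsto_nhds_unique h1 (tendsto_euler_sin_prod y)
  rw [← h2, mul_div_cancel_left₀ _ hne]

theorem sineProd_zero : sineProd 0 = 1 := by simp [sineProd]

theorem hasProd_weierstrassFactor_div_sq (w : ℂ) :
    HasProd (fun k : ℕ => weierstrassFactor (w / ((k : ℂ) + 1) ^ 2))
      (sineProd w * cexp (zetaSum 0 * w)) :=
  (hasProd_sineProd w).mul (hasSum_div_sq w).cexp

/-- The characteristic series of the `Â`-genus is the inverse of the sine product. -/
theorem ahatQ_mul_sq (x z : ℂ) :
    ahatQ (x * (2 * (Real.pi : ℂ) * I * z) ^ 2) = (sineProd (z ^ 2 * x))⁻¹ := by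
  obtain ⟨y, hy⟩ := IsAlgClosed.exists_pow_nat_eq (z ^ 2 * x) zero_lt_two
  have e : x * (2 * (Real.pi : ℂ) * I * z) ^ 2 = (2 * (Real.pi : ℂ) * I * y) ^ 2 := by
    linear_combination (-(4 * (Real.pi : ℂ) ^ 2 * I ^ 2)) * hy
  rw [e, ← hy]
  rcases eq_or_ne y 0 with rfl | h0
  · simp [sineProd_zero, ahatQ]
  · have hpi : (Real.pi : ℂ) ≠ 0 := by exact_mod_cast Real.pi_ne_zero
    rw [ahatQ_sq (by simp [hpi, h0, I_ne_zero]), sineProd_sq h0,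
      show 2 * (Real.pi : ℂ) * I * y / 2 = Real.pi * y * I by ring, sinh_mul_I, inv_div,
      mul_div_mul_right _ _ I_ne_zero]

end Sine

/-! ### The product over one row of the lattice. -/

section Rows

/-- Each factor is `(w + n - z)(w + n + z) / (w + n)²`, and pairing `n` with `-n` produces Euler's
products for `w - z`, `w + z` and `w`. -/
theorem hasProd_one_sub_div_add_int_sq {w z : ℂ} (hw : 0 < w.im) (hz : z ^ 2 ≠ w ^ 2) :
    HasProd (fun n : ℤ => 1 - z ^ 2 / (w + n) ^ 2)
      (sin (Real.pi * (w - z)) * sin (Real.pi * (w + z)) / sin (Real.pi * w) ^ 2) := by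
  have hne (n : ℤ) : w + n ≠ 0 := ne_zero_of_im_pos (by simpa using hw)
  have hsum : Summable fun n : ℤ => ‖-(z ^ 2 / (w + n) ^ 2)‖ := by
    have h := ((EisensteinSeries.linear_right_summable w 1 (k := 2) le_rfl).mul_left (z ^ 2)).norm
    simpa [div_eq_mul_inv, zpow_ofNat] using h
  have hmul : Multipliable fun n : ℤ => 1 - z ^ 2 / (w + n) ^ 2 := by
    simpa only [← sub_eq_add_neg] using multipliable_one_add_of_summable hsum
  set f : ℤ → ℂ := fun n => 1 - z ^ 2 / (w + n) ^ 2 with hf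
  have hw0 : w ≠ 0 := by simpa using hne 0
  have hf0 : f 0 ≠ 0 := by
    simp only [hf, Int.cast_zero, add_zero]
    rw [sub_ne_zero, ne_comm, ne_eq, div_eq_one_iff_eq (pow_ne_zero 2 hw0)]
    exact hz
  let A : ℕ → ℂ → ℂ := fun N a =>
    Real.pi * a * ∏ j ∈ Finset.range N, (1 - a ^ 2 / ((j : ℂ) + 1) ^ 2)
  have hA (a : ℂ) : Tendsto (fun N => A N a) atTop (𝓝 (sin (Real.pi * a))) :=
    tendsto_euler_sin_prod a
  have hpi : (Real.pi : ℂ) ≠ 0 := by exact_mod_cast Real.pi_ne_zero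
  have hsin : sin (Real.pi * w) ≠ 0 := by
    refine sin_ne_zero_iff.mpr fun k hk => ?_
    have : w = k := mul_left_cancel₀ hpi (by rw [hk, mul_comm])
    rw [this] at hw
    simp at hw
  have hfac (j : ℕ) : f ((j : ℤ) + 1) * f (-((j : ℤ) + 1)) =
      (1 - (w - z) ^ 2 / ((j : ℂ) + 1) ^ 2) * (1 - (w + z) ^ 2 / ((j : ℂ) + 1) ^ 2) /
        (1 - w ^ 2 / ((j : ℂ) + 1) ^ 2) ^ 2 := by
    have h1 := hne (j + 1)
    have h2 := hne (-(j + 1))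
    have h3 : (j : ℂ) + 1 ≠ 0 := Nat.cast_add_one_ne_zero j
    push_cast at h1 h2
    have h4 : 1 - w ^ 2 / ((j : ℂ) + 1) ^ 2 =
        -((w + (j + 1)) * (w + -(j + 1))) / ((j : ℂ) + 1) ^ 2 := by field_simp; ring
    rw [h4]
    simp only [hf]
    push_cast
    field_simp
    ring
  have hA0 (N : ℕ) : A N w ≠ 0 := by
    refine mul_ne_zero (mul_ne_zero hpi hw0) (Finset.prod_ne_zero_iff.mpr fun j _ => ?_)
    have h1 := hne (j + 1)
    have h2 := hne (-(j + 1))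
    have h3 : (j : ℂ) + 1 ≠ 0 := Nat.cast_add_one_ne_zero j
    push_cast at h1 h2
    have h4 : 1 - w ^ 2 / ((j : ℂ) + 1) ^ 2 =
        -((w + (j + 1)) * (w + -(j + 1))) / ((j : ℂ) + 1) ^ 2 := by field_simp; ring
    rw [h4]
    exact div_ne_zero (neg_ne_zero.mpr (mul_ne_zero h1 h2)) (pow_ne_zero 2 h3)
  -- The pairing counts `f 0` twice; the surplus factor is cancelled at the end, which needs `z² ≠
  -- w²`.
  have hpart (N : ℕ) : ∏ n ∈ Finset.range (N + 1), f (n : ℤ) * f (-(n : ℤ)) =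
      f 0 * (A N (w - z) * A N (w + z) / A N w ^ 2) := by
    have hA0N := hA0 N
    have hprod : ∏ j ∈ Finset.range N, (1 - w ^ 2 / ((j : ℂ) + 1) ^ 2) ≠ 0 :=
      right_ne_zero_of_mul hA0N
    rw [Finset.prod_range_succ']
    simp only [Nat.cast_add, Nat.cast_one, hfac, Nat.cast_zero, neg_zero, A]
    rw [Finset.prod_div_distrib, Finset.prod_mul_distrib, Finset.prod_pow]
    have e0 : f 0 = (w - z) * (w + z) / w ^ 2 := by
      simp only [hf, Int.cast_zero, add_zero]
      field_simp
      ring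
    rw [e0]
    field_simp
  have h1 := (hmul.hasProd.nat_mul_neg.tendsto_prod_nat).comp (tendsto_add_atTop_nat 1)
  have h2 : Tendsto (fun N => f 0 * (A N (w - z) * A N (w + z) / A N w ^ 2)) atTop
      (𝓝 (f 0 * (sin (Real.pi * (w - z)) * sin (Real.pi * (w + z)) / sin (Real.pi * w) ^ 2))) :=
    (((hA _).mul (hA _)).div ((hA w).pow 2) (pow_ne_zero 2 hsin)).const_mul _
  have h3 := tendsto_nhds_unique h1 (h2.congr fun N => (hpart N).symm)
  rw [mul_comm] at h3
  rw [← mul_left_cancel₀ hf0 h3]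
  exact hmul.hasProd

theorem sin_mul_sin_div_sin_sq {w : ℂ} (hw : 0 < w.im) (z : ℂ) :
    sin (Real.pi * (w - z)) * sin (Real.pi * (w + z)) / sin (Real.pi * w) ^ 2 =
      (1 - cexp (2 * Real.pi * I * z) * cexp (2 * Real.pi * I * w)) *
        (1 - (cexp (2 * Real.pi * I * z))⁻¹ * cexp (2 * Real.pi * I * w)) /
          (1 - cexp (2 * Real.pi * I * w)) ^ 2 := by
  have hs (a : ℂ) : sin (Real.pi * a) =
      ((cexp (Real.pi * I * a))⁻¹ - cexp (Real.pi * I * a)) * I / 2 := by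
    rw [sin, ← Complex.exp_neg]; congr 3
    · congr 1; ring_nf
    · congr 1; ring
  have h2 (a : ℂ) : cexp (2 * Real.pi * I * a) = cexp (Real.pi * I * a) ^ 2 := by
    rw [← Complex.exp_nat_mul]; congr 1; push_cast; ring
  have hq : 1 - cexp (Real.pi * I * w) ^ 2 ≠ 0 := by
    rw [← h2]
    intro h
    have h3 := UpperHalfPlane.norm_exp_two_pi_I_lt_one ⟨w, hw⟩
    rw [show cexp (2 * Real.pi * I * w) = 1 from (sub_eq_zero.mp h).symm] at h3
    simp at h3
  rw [hs, hs, hs, h2, h2, mul_sub, mul_add, Complex.exp_sub, Complex.exp_add]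
  have hx := Complex.exp_ne_zero (Real.pi * I * w)
  have hy := Complex.exp_ne_zero (Real.pi * I * z)
  set x := cexp (Real.pi * I * w)
  set y := cexp (Real.pi * I * z)
  have e : (x⁻¹ - x) * I / 2 = (1 - x ^ 2) * I / (2 * x) := by field_simp
  rw [e]
  field_simp

end Rows

/-! ### The regularized product over the lattice and its limit. -/

section Reg

variable (τ : UpperHalfPlane)

/-- The argument of the Weierstrass factor attached to a multiple of a coprime pair. -/
noncomputable def regArg (s : ℝ) (z : ℂ) (x : PrimHalf × ℕ) : ℂ :=
  z ^ 2 * heckeTerm s (latticePt τ x.1.1) / ((x.2 : ℂ) + 1) ^ 2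

/-- The argument is `O(|λ|⁻²)` at the lattice point `λ`, so the quadratic estimate gives `|λ|⁻⁴`,
uniformly in `s`. -/
theorem exists_weierstrassFactor_regArg_bound (z : ℂ) (A : ℝ) :
    ∃ C : ℝ, ∀ s : ℝ, 0 ≤ s → s ≤ A → ∀ x : PrimHalf × ℕ,
      ‖weierstrassFactor (regArg τ s z x) - 1‖ ≤
        C * ‖latticePt τ (primHalfProdEquiv x).1‖ ^ (-4 : ℝ) := by
  obtain ⟨δ, hδ, hle⟩ := exists_le_norm_latticePt τ
  set M : ℝ := ‖z‖ ^ 2 * max 1 (δ ^ (-A)) with hM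
  have hM0 : 0 ≤ M := by positivity
  -- As `|λ| ≥ δ`, this radius contains every argument that occurs.
  obtain ⟨C, hC0, hC⟩ := exists_norm_weierstrassFactor_sub_one_le (M * (δ ^ 2)⁻¹)
  refine ⟨C * M ^ 2, fun s hs0 hsA x => ?_⟩
  set L := ‖latticePt τ (primHalfProdEquiv x).1‖ with hL
  have hLδ : δ ≤ L := hle _ (primHalfProdEquiv x).ne_zero
  have hL0 : 0 < L := hδ.trans_le hLδ
  have hx := hle _ x.1.ne_zero
  have hx0 : 0 < ‖latticePt τ x.1.1‖ := hδ.trans_le hx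
  have hLeq : L = ((x.2 : ℝ) + 1) * ‖latticePt τ x.1.1‖ := by
    rw [hL, latticePt_primHalfProdEquiv, norm_mul]
    congr 1
    exact_mod_cast Complex.norm_natCast (x.2 + 1)
  have hnorm : ‖regArg τ s z x‖ ≤ M * (L ^ 2)⁻¹ := by
    have h1 : ‖((x.2 : ℂ) + 1) ^ 2‖ = ((x.2 : ℝ) + 1) ^ 2 := by
      rw [norm_pow]; congr 1; exact_mod_cast Complex.norm_natCast (x.2 + 1)
    have h2 := rpow_neg_le_max hδ hx hs0 hsA
    rw [regArg, norm_div, norm_mul, norm_pow, h1, norm_heckeTerm s (latticePt_ne_zero τ x.1.ne_zero),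
      neg_add, Real.rpow_add hx0, Real.rpow_neg hx0.le, hLeq, hM]
    rw [show ‖latticePt τ x.1.1‖ ^ (2 : ℝ) = ‖latticePt τ x.1.1‖ ^ 2 by norm_cast]
    calc _ = ‖z‖ ^ 2 * ‖latticePt τ x.1.1‖ ^ (-s) *
          ((((x.2 : ℝ) + 1) * ‖latticePt τ x.1.1‖) ^ 2)⁻¹ := by field_simp
      _ ≤ _ := by gcongr
  have h4 : L ^ (-4 : ℝ) = ((L ^ 2)⁻¹) ^ 2 := by
    rw [Real.rpow_neg hL0.le, inv_pow, ← pow_mul]; norm_cast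
  calc ‖weierstrassFactor (regArg τ s z x) - 1‖ ≤ C * ‖regArg τ s z x‖ ^ 2 :=
        hC _ (hnorm.trans (by gcongr))
    _ ≤ C * (M * (L ^ 2)⁻¹) ^ 2 := by gcongr
    _ = _ := by rw [h4]; ring

theorem summable_norm_primHalfProdEquiv {r : ℝ} (hr : 2 < r) :
    Summable fun x : PrimHalf × ℕ => ‖latticePt τ (primHalfProdEquiv x).1‖ ^ (-r) :=
  (summable_norm_latticePt_rpow τ hr).comp_injective
    (Subtype.val_injective.comp primHalfProdEquiv.injective)

/-- The regularized Weierstrass product. -/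
noncomputable def regProd (s : ℝ) (z : ℂ) : ℂ :=
  ∏' x : PrimHalf × ℕ, weierstrassFactor (regArg τ s z x)

theorem summable_norm_weierstrassFactor_regArg {s : ℝ} (hs : 0 ≤ s) (z : ℂ) :
    Summable fun x => ‖weierstrassFactor (regArg τ s z x) - 1‖ := by
  obtain ⟨C, hC⟩ := exists_weierstrassFactor_regArg_bound τ z s
  exact Summable.of_nonneg_of_le (fun _ => norm_nonneg _) (hC s hs le_rfl)
    ((summable_norm_primHalfProdEquiv τ (by norm_num)).mul_left C)

theorem hasProd_regProd {s : ℝ} (hs : 0 ≤ s) (z : ℂ) :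
    HasProd (fun x => weierstrassFactor (regArg τ s z x)) (regProd τ s z) := by
  have := multipliable_one_add_of_summable (summable_norm_weierstrassFactor_regArg τ hs z)
  simp only [add_sub_cancel] at this
  exact this.hasProd

theorem regProd_ne_zero_iff {s : ℝ} (hs : 0 ≤ s) (z : ℂ) :
    regProd τ s z ≠ 0 ↔ ∀ x, regArg τ s z x ≠ 1 := by
  constructor
  · intro h x hx
    exact h (tprod_of_exists_eq_zero ⟨x, weierstrassFactor_eq_zero_iff.mpr hx⟩)
  · intro h
    have := tprod_one_add_ne_zero_of_summable
      (f := fun x => weierstrassFactor (regArg τ s z x) - 1)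
      (fun x => by rw [add_sub_cancel]; exact mt weierstrassFactor_eq_zero_iff.mp (h x))
      (summable_norm_weierstrassFactor_regArg τ hs z)
    simpa only [regProd, add_sub_cancel] using this

theorem tendsto_heckeTerm {w : ℂ} (hw : w ≠ 0) :
    Tendsto (fun s => heckeTerm s w) (𝓝[>] 0) (𝓝 (heckeTerm 0 w)) := by
  have h : Continuous fun s : ℝ => heckeTerm s w := by
    unfold heckeTerm
    exact continuous_const.mul (continuous_ofReal.comp (Continuous.rpow continuous_const
      (by fun_prop) fun _ => Or.inl (normSq_pos.mpr hw).ne'))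
  exact (h.tendsto 0).mono_left nhdsWithin_le_nhds

theorem tendsto_regProd (z : ℂ) :
    Tendsto (fun s => regProd τ s z) (𝓝[>] 0) (𝓝 (regProd τ 0 z)) := by
  obtain ⟨C, hC⟩ := exists_weierstrassFactor_regArg_bound τ z 1
  have := tendsto_tprod_one_add_of_dominated_convergence (𝓕 := 𝓝[>] (0 : ℝ))
    (f := fun s x => weierstrassFactor (regArg τ s z x) - 1)
    (g := fun x => weierstrassFactor (regArg τ 0 z x) - 1)
    ((summable_norm_primHalfProdEquiv τ (r := 4) (by norm_num)).mul_left C)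
    (fun x => ((continuous_weierstrassFactor.tendsto _).comp
      (((tendsto_heckeTerm (latticePt_ne_zero τ x.1.ne_zero)).const_mul _).div_const _)).sub_const 1)
    (by
      filter_upwards [Ioo_mem_nhdsGT (zero_lt_one' ℝ)] with s hs
      exact hC s hs.1.le hs.2.le)
  simpa only [regProd, add_sub_cancel] using this

theorem summable_heckeTerm_primHalf {s : ℝ} (hs : 0 < s) :
    Summable fun p : PrimHalf => heckeTerm s (latticePt τ p.1) := by
  refine Summable.of_norm ?_
  simp only [norm_heckeTerm s (latticePt_ne_zero τ (PrimHalf.ne_zero _))]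
  exact (summable_norm_latticePt_rpow τ (by linarith)).comp_injective Subtype.val_injective

/-- The regularized Eisenstein series over the coprime pairs up to sign. -/
noncomputable def primSum (s : ℝ) : ℂ := ∑' p : PrimHalf, heckeTerm s (latticePt τ p.1)

/-- Multiplying first over `k` gives a sine product times `exp (ζ(2) z² x)` for each coprime pair.
These exponentials can be divided out because the sum over pairs converges for `s > 0`. -/
theorem hasProd_sineProd_primHalf {s : ℝ} (hs : 0 < s) (z : ℂ) :
    HasProd (fun p : PrimHalf => sineProd (z ^ 2 * heckeTerm s (latticePt τ p.1)))
      (regProd τ s z * cexp (-(zetaSum 0 * (z ^ 2 * primSum τ s)))) := by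
  have h1 := (hasProd_regProd τ hs.le z).prod_fiberwise
    (fun p => hasProd_weierstrassFactor_div_sq (z ^ 2 * heckeTerm s (latticePt τ p.1)))
  have h2 := ((((summable_heckeTerm_primHalf τ hs).hasSum.mul_left (z ^ 2)).mul_left
    (zetaSum 0 : ℂ)).neg).cexp
  refine (h1.mul h2).congr_fun fun p => ?_
  rw [Function.comp_apply, mul_assoc, ← Complex.exp_add, add_neg_cancel, Complex.exp_zero, mul_one]

theorem heckeTerm_mul_of_pos (s : ℝ) {b : ℝ} (hb : 0 < b) (w : ℂ) :
    heckeTerm s (b * w) = ((b ^ (-(2 + s)) : ℝ) : ℂ) * heckeTerm s w := by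
  have h2 : b ^ (-(2 + s)) = (b ^ 2)⁻¹ * b ^ (-s) := by
    rw [neg_add, Real.rpow_add hb, Real.rpow_neg hb.le]; norm_num
  rw [heckeTerm, heckeTerm, normSq_rpow, normSq_rpow, norm_mul, norm_real,
    Real.norm_of_nonneg hb.le, Real.mul_rpow hb.le (norm_nonneg _), h2]
  push_cast
  ring

/-- Two evaluations of the sum over half the lattice: by multiples of coprime pairs, using
homogeneity of degree `-(2 + s)`, and by row `0` plus the rows above it. -/
theorem zetaSum_mul_primSum {s : ℝ} (hs : 0 < s) :
    zetaSum s * primSum τ s = zetaSum s + ∑' y, heckeTerm s (upperPt τ y) := by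
  have hz := hasSum_ofReal.mpr (summable_zetaSum hs.le).hasSum
  have hone : heckeTerm s 1 = 1 := by simp [heckeTerm]
  have hsum : Summable fun p : HalfLattice => heckeTerm s (latticePt τ p.1) := by
    refine Summable.of_norm ?_
    simp only [norm_heckeTerm s (latticePt_ne_zero τ (HalfLattice.ne_zero _))]
    exact (summable_norm_latticePt_rpow τ (by linarith)).comp_injective Subtype.val_injective
  have h1 : HasSum (fun x : ℕ ⊕ (ℕ × ℤ) => heckeTerm s (latticePt τ (sumEquivHalfLattice x).1))
      (zetaSum s + ∑' y, heckeTerm s (upperPt τ y)) := by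
    refine HasSum.sum (hz.congr_fun fun n => ?_)
      ((summable_heckeTerm_upperPt τ hs).hasSum.congr_fun fun y => ?_)
    · rw [Function.comp_apply, latticePt_sumEquiv_inl]
      have := heckeTerm_mul_of_pos s (b := (n : ℝ) + 1) (by positivity) 1
      rw [hone, mul_one, mul_one] at this
      rw [← this]
      push_cast; rfl
    · rw [Function.comp_apply, latticePt_sumEquiv_inr]
  have h2 : HasSum (fun x : PrimHalf × ℕ => heckeTerm s (latticePt τ (primHalfProdEquiv x).1))
      (∑' p : HalfLattice, heckeTerm s (latticePt τ p.1)) :=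
    primHalfProdEquiv.hasSum_iff.mpr hsum.hasSum
  have h3 : ∑' p : HalfLattice, heckeTerm s (latticePt τ p.1) =
      zetaSum s + ∑' y, heckeTerm s (upperPt τ y) :=
    hsum.hasSum.unique (sumEquivHalfLattice.hasSum_iff.mp h1)
  have h4 := h2.prod_fiberwise (g := fun p => zetaSum s * heckeTerm s (latticePt τ p.1)) fun p => by
    refine (hz.mul_right (heckeTerm s (latticePt τ p.1))).congr_fun fun k => ?_
    rw [latticePt_primHalfProdEquiv, ← heckeTerm_mul_of_pos s (by positivity)]
    push_cast; rfl
  rw [← h3, primSum, ← tsum_mul_left]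
  exact h4.tsum_eq

/-- The exponent carries `ζ(2)`, since `|·|^(-s)` is applied only to the coprime point, while
Hecke's series carries `ζ(2 + s)`; the ratio tends to `1`. -/
theorem tendsto_zetaSum_mul_primSum :
    Tendsto (fun s => (zetaSum 0 : ℂ) * primSum τ s) (𝓝[>] 0)
      (𝓝 (zetaSum 0 + (eisensteinRows τ - Real.pi / (2 * τ.im)))) := by
  have hz0 : (zetaSum 0 : ℂ) ≠ 0 := by exact_mod_cast zetaSum_zero_pos.ne'
  have hz : Tendsto (fun s => (zetaSum s : ℂ)) (𝓝[>] 0) (𝓝 (zetaSum 0 : ℂ)) :=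
    (continuous_ofReal.tendsto _).comp tendsto_zetaSum
  have h := ((hz.add (tendsto_tsum_heckeTerm τ)).div hz hz0).const_mul (zetaSum 0 : ℂ)
  rw [mul_div_cancel₀ _ hz0] at h
  refine h.congr' ?_
  have hne : ∀ᶠ s in 𝓝[>] (0 : ℝ), (zetaSum s : ℂ) ≠ 0 := hz.eventually_ne hz0
  filter_upwards [self_mem_nhdsWithin, hne] with s hs hs0
  simp only [Pi.div_apply]
  rw [← zetaSum_mul_primSum τ hs, mul_div_cancel_left₀ _ hs0]

theorem regArg_zero (z : ℂ) (x : PrimHalf × ℕ) :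
    regArg τ 0 z x = z ^ 2 / latticePt τ (primHalfProdEquiv x).1 ^ 2 := by
  rw [regArg, heckeTerm_zero, latticePt_primHalfProdEquiv]
  field_simp

/-- Evaluation of the Weierstrass product by rows. -/
theorem regProd_zero {z : ℂ} (hz : ∀ p, z ≠ latticePt τ p) :
    regProd τ 0 z = sineProd (z ^ 2) * cexp (zetaSum 0 * z ^ 2) *
      (thetaProd (cexp (2 * Real.pi * I * τ)) (cexp (2 * Real.pi * I * z)) *
        cexp (z ^ 2 * eisensteinRows τ)) := by
  have hH : HasProd (fun p : HalfLattice => weierstrassFactor (z ^ 2 / latticePt τ p.1 ^ 2))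
      (regProd τ 0 z) := by
    have := hasProd_regProd τ le_rfl z
    simp only [regArg_zero] at this
    exact (primHalfProdEquiv.hasProd_iff
      (f := fun p : HalfLattice => weierstrassFactor (z ^ 2 / latticePt τ p.1 ^ 2))).mp this
  have hnorm : Summable fun p : HalfLattice =>
      ‖weierstrassFactor (z ^ 2 / latticePt τ p.1 ^ 2) - 1‖ := by
    have := summable_norm_weierstrassFactor_regArg τ le_rfl z
    simp only [regArg_zero] at this
    exact (primHalfProdEquiv.summable_iff
      (f := fun p : HalfLattice => ‖weierstrassFactor (z ^ 2 / latticePt τ p.1 ^ 2) - 1‖)).mp this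
  have hup : Multipliable fun y => weierstrassFactor (z ^ 2 / upperPt τ y ^ 2) := by
    have h1 := hnorm.comp_injective (sumEquivHalfLattice.injective.comp Sum.inr_injective)
    simp only [Function.comp_def, latticePt_sumEquiv_inr] at h1
    simpa only [add_sub_cancel] using multipliable_one_add_of_summable h1
  -- Row `0` is the sine product with its exponential; the rows above are treated next.
  have hsplit := HasProd.sum (f := fun x : ℕ ⊕ (ℕ × ℤ) =>
      weierstrassFactor (z ^ 2 / latticePt τ (sumEquivHalfLattice x).1 ^ 2))
    (by simpa only [Function.comp_def, latticePt_sumEquiv_inl] using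
      hasProd_weierstrassFactor_div_sq (z ^ 2))
    (by simpa only [Function.comp_def, latticePt_sumEquiv_inr] using hup.hasProd)
  rw [hH.unique (sumEquivHalfLattice.hasProd_iff.mp hsplit)]
  congr 1
  have hrow (m : ℕ) : HasProd (fun n : ℤ => weierstrassFactor (z ^ 2 / upperPt τ (m, n) ^ 2))
      ((1 - cexp (2 * Real.pi * I * z) * cexp (2 * Real.pi * I * τ) ^ (m + 1)) *
        (1 - (cexp (2 * Real.pi * I * z))⁻¹ * cexp (2 * Real.pi * I * τ) ^ (m + 1)) /
          (1 - cexp (2 * Real.pi * I * τ) ^ (m + 1)) ^ 2 *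
        cexp (z ^ 2 * ∑' n : ℤ, (upperPt τ (m, n) ^ 2)⁻¹)) := by
    have hadd (n : ℤ) : upperPt τ (m, n) = upperPt τ (m, 0) + n := by simp [upperPt_eq]
    have h1 := hasProd_one_sub_div_add_int_sq (z := z) (upperPt_im_pos τ (m, 0)) (by
      intro h
      rcases sq_eq_sq_iff_eq_or_eq_neg.mp h with h | h
      · exact hz _ h
      · rw [upperPt, ← latticePt_neg] at h
        exact hz _ h)
    rw [sin_mul_sin_div_sin_sq (upperPt_im_pos τ _)] at h1
    have hq : cexp (2 * Real.pi * I * upperPt τ (m, 0)) = cexp (2 * Real.pi * I * τ) ^ (m + 1) := by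
      rw [← Complex.exp_nat_mul, upperPt_eq]
      congr 1; push_cast; ring
    rw [hq] at h1
    have h2 := ((summable_inv_upperPt_sq τ m).hasSum.mul_left (z ^ 2)).cexp
    refine (h1.mul h2).congr_fun fun n => ?_
    rw [Function.comp_apply, ← hadd, weierstrassFactor, div_eq_mul_inv]
  have h3 := hup.hasProd.prod_fiberwise hrow
  have h4 := (hasProd_thetaProd (UpperHalfPlane.norm_exp_two_pi_I_lt_one τ)
    (cexp (2 * Real.pi * I * z))).mul ((hasSum_eisensteinRows τ).mul_left (z ^ 2)).cexp
  exact h3.unique h4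

end Reg

end

/-! ### Assembling the limit of the genus. -/

open Complex Filter Topology

section Main

variable (τ : UpperHalfPlane)

theorem ahatRegular_iff (x z : ℂ) :
    AhatRegular (x * (2 * (Real.pi : ℂ) * I * z) ^ 2) ↔
      ∀ k : ℕ, z ^ 2 * x / ((k : ℂ) + 1) ^ 2 ≠ 1 := by
  have hpi : (Real.pi : ℂ) ≠ 0 := by exact_mod_cast Real.pi_ne_zero
  have key (k : ℕ) : x * (2 * (Real.pi : ℂ) * I * z) ^ 2 =
      -(2 * (Real.pi : ℂ) * ((k + 1 : ℕ) : ℂ)) ^ 2 ↔ z ^ 2 * x / ((k : ℂ) + 1) ^ 2 = 1 := by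
    have hk : ((k : ℂ) + 1) ^ 2 ≠ 0 := pow_ne_zero 2 (Nat.cast_add_one_ne_zero k)
    have e1 : x * (2 * (Real.pi : ℂ) * I * z) ^ 2 = -(2 * (Real.pi : ℂ)) ^ 2 * (z ^ 2 * x) := by
      linear_combination 4 * (Real.pi : ℂ) ^ 2 * z ^ 2 * x * I_sq
    have e2 : -(2 * (Real.pi : ℂ) * ((k + 1 : ℕ) : ℂ)) ^ 2 =
        -(2 * (Real.pi : ℂ)) ^ 2 * ((k : ℂ) + 1) ^ 2 := by push_cast; ring
    have h0 : -(2 * (Real.pi : ℂ)) ^ 2 ≠ 0 := by simp [hpi]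
    rw [e1, e2, div_eq_one_iff_eq hk, mul_right_inj' h0]
  constructor
  · intro h k hk
    exact h (k + 1) (by omega) ((key k).mpr hk)
  · rintro h k hk1 hk
    obtain ⟨j, rfl⟩ := Nat.exists_eq_add_of_le' hk1
    exact h j ((key j).mp hk)

/-- Poles of the factors are the zeros of the Weierstrass factors, and an absolutely convergent
product vanishes only if a factor does. -/
theorem forall_ahatRegular_iff {s : ℝ} (hs : 0 < s) (z : ℂ) :
    (∀ x ∈ ahatX τ s, AhatRegular (x * (2 * (Real.pi : ℂ) * I * z) ^ 2)) ↔
      regProd τ s z ≠ 0 := by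
  have hset : (∀ x ∈ ahatX τ s, AhatRegular (x * (2 * (Real.pi : ℂ) * I * z) ^ 2)) ↔
      ∀ x : ahatX τ s, AhatRegular ((x : ℂ) * (2 * (Real.pi : ℂ) * I * z) ^ 2) :=
    ⟨fun h x => h x x.2, fun h x hx => h ⟨x, hx⟩⟩
  rw [hset, regProd_ne_zero_iff τ hs.le, Prod.forall,
    ← (ahatXEquiv τ hs).forall_congr_right (q := fun x : ahatX τ s =>
      AhatRegular ((x : ℂ) * (2 * (Real.pi : ℂ) * I * z) ^ 2))]
  simp only [ahatXEquiv_apply, ahatRegular_iff, regArg]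

theorem hasProd_ahatQ {s : ℝ} (hs : 0 < s) {z : ℂ} (h : regProd τ s z ≠ 0) :
    HasProd (fun x : ahatX τ s => ahatQ ((x : ℂ) * (2 * (Real.pi : ℂ) * I * z) ^ 2))
      (regProd τ s z * cexp (-(zetaSum 0 * (z ^ 2 * primSum τ s))))⁻¹ := by
  have h1 := (hasProd_sineProd_primHalf τ hs z).inv₀ (mul_ne_zero h (Complex.exp_ne_zero _))
  refine (ahatXEquiv τ hs).hasProd_iff.mp (h1.congr_fun fun p => ?_)
  rw [Function.comp_apply, ahatQ_mul_sq, ahatXEquiv_apply]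

theorem regProd_zero_ne_zero {z : ℂ} (hz : ∀ p, z ≠ latticePt τ p) : regProd τ 0 z ≠ 0 := by
  rw [regProd_ne_zero_iff τ le_rfl]
  intro x hx
  have hne := latticePt_ne_zero τ (primHalfProdEquiv x).ne_zero
  rw [regArg_zero, div_eq_one_iff_eq (pow_ne_zero 2 hne)] at hx
  rcases sq_eq_sq_iff_eq_or_eq_neg.mp hx with h | h
  · exact hz _ h
  · rw [← latticePt_neg] at h
    exact hz _ h

/-- The Eisenstein and `ζ(2)` exponentials of the row evaluation cancel, leaving exactly the
Gaussian factor of `modTheta`. -/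
theorem modTheta_eq_regProd {z : ℂ} (hz : ∀ p, z ≠ latticePt τ p) :
    modTheta z τ = 2 * Real.pi * I * z * (regProd τ 0 z *
      cexp (-(z ^ 2 * (zetaSum 0 + (eisensteinRows τ - Real.pi / (2 * τ.im)))))) := by
  have hpi : (Real.pi : ℂ) ≠ 0 := by exact_mod_cast Real.pi_ne_zero
  have hz0 : z ≠ 0 := by simpa [latticePt] using hz 0
  have hexp : cexp (Real.pi / 2 * (z ^ 2 / τ.im)) = cexp (zetaSum 0 * z ^ 2) *
      cexp (z ^ 2 * eisensteinRows τ) *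
        cexp (-(z ^ 2 * (zetaSum 0 + (eisensteinRows τ - Real.pi / (2 * τ.im))))) := by
    rw [← Complex.exp_add, ← Complex.exp_add]
    congr 1
    have : (τ.im : ℂ) ≠ 0 := by exact_mod_cast τ.im_pos.ne'
    field_simp
    ring
  rw [modTheta_eq, regProd_zero τ hz, sineProd_sq hz0, hexp]
  field_simp

theorem tendsto_two_pi_I_mul_inv_modTheta :
    Tendsto (fun z : ℂ => 2 * (Real.pi : ℂ) * I * z * (modTheta z τ)⁻¹) (𝓝[≠] 0) (𝓝 1) := by
  have hpi : (Real.pi : ℂ) ≠ 0 := by exact_mod_cast Real.pi_ne_zero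
  have h1 : Tendsto (fun z : ℂ => z⁻¹ * sin (Real.pi * z)) (𝓝[≠] 0) (𝓝 Real.pi) := by
    have hd : HasDerivAt (fun z : ℂ => sin (Real.pi * z)) Real.pi 0 := by
      have := ((hasDerivAt_id (0 : ℂ)).const_mul (Real.pi : ℂ)).csin
      simpa using this
    simpa using hd.tendsto_slope_zero
  have h2 : Tendsto (fun z : ℂ => cexp ((Real.pi : ℂ) / 2 * (z ^ 2 / (τ.im : ℂ)))) (𝓝[≠] 0)
      (𝓝 1) := by
    have : Continuous fun z : ℂ => cexp ((Real.pi : ℂ) / 2 * (z ^ 2 / (τ.im : ℂ))) := by fun_prop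
    simpa using (this.tendsto 0).mono_left (nhdsWithin_le_nhds (s := {0}ᶜ))
  have h3 := (tendsto_thetaProd_one (UpperHalfPlane.norm_exp_two_pi_I_lt_one τ)).mono_left
    (nhdsWithin_le_nhds (s := {0}ᶜ))
  have h4 := (((h2.inv₀ one_ne_zero).mul (h1.inv₀ hpi)).mul (h3.inv₀ one_ne_zero)).const_mul
    (Real.pi : ℂ)
  simp only [inv_one, one_mul, mul_one, mul_inv_cancel₀ hpi] at h4
  -- The identity also holds at `z = 0`, where both sides are `0` because `0⁻¹ = 0`.
  refine h4.congr fun z => ?_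
  simp only [modTheta_eq, mul_inv, inv_inv]
  field_simp

end Main

theorem theorem1p1 (τ : UpperHalfPlane) :
    -- for every `s > 0` the product converges unconditionally, unless a factor has a pole
    (∀ z : ℂ, ∀ s : ℝ, 0 < s →
      (∀ x ∈ ahatX τ s, AhatRegular (x * (2 * (Real.pi : ℂ) * Complex.I * z) ^ 2)) →
      Multipliable (fun x : ahatX τ s =>
        ahatQ ((x : ℂ) * (2 * (Real.pi : ℂ) * Complex.I * z) ^ 2))) ∧
    -- away from the lattice `ℤτ + ℤ`
    (∀ z : ℂ, (∀ m n : ℤ, z ≠ (m : ℂ) * (τ : ℂ) + (n : ℂ)) →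
      (∀ᶠ s : ℝ in nhdsWithin 0 (Set.Ioi 0), ∀ x ∈ ahatX τ s,
        AhatRegular (x * (2 * (Real.pi : ℂ) * Complex.I * z) ^ 2)) ∧
      modTheta z τ ≠ 0 ∧
      Filter.Tendsto
        (fun s : ℝ => ahatProd (ahatX τ s) ((2 * (Real.pi : ℂ) * Complex.I * z) ^ 2))
        (nhdsWithin 0 (Set.Ioi 0))
        (nhds (2 * (Real.pi : ℂ) * Complex.I * z * (modTheta z τ)⁻¹))) ∧
    -- at `z = 0`, where the right-hand side has a removable singularity
    (Filter.Tendsto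
        (fun s : ℝ => ahatProd (ahatX τ s) ((2 * (Real.pi : ℂ) * Complex.I * 0) ^ 2))
        (nhdsWithin 0 (Set.Ioi 0)) (nhds 1) ∧
      Filter.Tendsto
        (fun z : ℂ => 2 * (Real.pi : ℂ) * Complex.I * z * (modTheta z τ)⁻¹)
        (nhdsWithin 0 {0}ᶜ) (nhds 1)) := by
  have hlattice {z : ℂ} (hz : ∀ m n : ℤ, z ≠ (m : ℂ) * (τ : ℂ) + (n : ℂ)) :
      ∀ p, z ≠ latticePt τ p := fun p => hz p.1 p.2
  refine ⟨fun z s hs h => ?_, fun z hz => ?_, ?_, tendsto_two_pi_I_mul_inv_modTheta τ⟩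
  · exact (hasProd_ahatQ τ hs ((forall_ahatRegular_iff τ hs z).mp h)).multipliable
  · have hz := hlattice hz
    have hne := regProd_zero_ne_zero τ hz
    have hz0 : z ≠ 0 := by simpa [latticePt] using hz 0
    have hpi : 2 * (Real.pi : ℂ) * Complex.I * z ≠ 0 := by
      simp [Real.pi_ne_zero, Complex.I_ne_zero, hz0]
    -- Continuity at `s = 0` carries nonvanishing from the limit to small `s`, which yields
    -- regularity and permits inversion of the product.
    have hev : ∀ᶠ s : ℝ in 𝓝[>] 0, 0 < s ∧ regProd τ s z ≠ 0 :=
      eventually_mem_nhdsWithin.and ((tendsto_regProd τ z).eventually_ne hne)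
    refine ⟨hev.mono fun s hs => (forall_ahatRegular_iff τ hs.1 z).mpr hs.2, ?_, ?_⟩
    · rw [modTheta_eq_regProd τ hz]
      exact mul_ne_zero hpi (mul_ne_zero hne (Complex.exp_ne_zero _))
    · have hexp := ((tendsto_zetaSum_mul_primSum τ).const_mul (z ^ 2)).neg.cexp
      have hlim := ((tendsto_regProd τ z).mul hexp).inv₀ (mul_ne_zero hne (Complex.exp_ne_zero _))
      rw [modTheta_eq_regProd τ hz, mul_inv, mul_inv_cancel_left₀ hpi]
      refine hlim.congr' (hev.mono fun s hs => ?_)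
      have hprod : ahatProd (ahatX τ s) ((2 * (Real.pi : ℂ) * Complex.I * z) ^ 2) = _ :=
        (hasProd_ahatQ τ hs.1 hs.2).tprod_eq
      beta_reduce
      rw [hprod, mul_left_comm (z ^ 2)]
  · simp [ahatProd, ahatQ]
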